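/- Let $X$ be a compact connected Riemann surface with holomorphic cotangent bundle $K$, and let $L$ be a holomorphic line bundle on $X$ with $\deg L=0$. Let $\alpha\in H^0(X,L^2K)$ and $\beta\in H^0(X,L^{-2}K)$, and consider the rank-two Higgs bundle $(E,\Phi)$ with $$E=L\oplus L^{-1},\qquad \Phi=\begin{pmatrix}0&\alpha\\ \beta&0\end{pmatrix}.$$ Recall that $(E,\Phi)$ is *stable* if every $\Phi$-invariant holomorphic line subbundle of $E$ has negative degree; it is *polystable* if it is a direct sum of stable Higgs bundles of degree $0$, i.e. if it is stable or $E$ is the direct sum of two $\Phi$-invariant holomorphic line subbundles of degree $0$; it is *strictly polystable* if it is polystable but not stable. Call $\alpha$ and $\beta$ *proportional* if there is a holomorphic isomorphism $L^2\cong\mathcal O$ such that, under the induced identifications $L^2K\cong K\cong L^{-2}K$, one of $\alpha,\beta$ is a constant multiple of the other. Then: 1. if $\alpha=0$ and $\beta=0$, then $(E,\Phi)$ is strictly polystable; 2. if $\alpha\neq0$ and $\beta\neq0$, then $(E,\Phi)$ is polystable; if moreover $\alpha$ and $\beta$ are not proportional, then $(E,\Phi)$ is stable; 3. if exactly one of $\alpha,\beta$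 is zero, then $(E,\Phi)$ is neither stable nor polystable. -/

import Mathlib

open Bundle Manifold
open scoped ContDiff

noncomputable section

namespace HiggsSurface

variable {X : Type*} [TopologicalSpace X]

section Hom

/-- The normed space of continuous `ℂ`-linear maps from `F₁` to `F₂`, the model fibre of a
bundle of homomorphisms. (A synonym, because instance search does not handle nested spaces of
continuous linear maps well.) -/
def HomModel (F₁ F₂ : Type*) [NormedAddCommGroup F₁] [NormedSpace ℂ F₁]
    [NormedAddCommGroup F₂] [NormedSpace ℂ F₂] : Type _ := F₁ →L[ℂ] F₂

namespace HomModel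

variable (F₁ F₂ : Type*) [NormedAddCommGroup F₁] [NormedSpace ℂ F₁]
  [NormedAddCommGroup F₂] [NormedSpace ℂ F₂]

instance : NormedAddCommGroup (HomModel F₁ F₂) := inferInstanceAs (NormedAddCommGroup (F₁ →L[ℂ] F₂))

instance : NormedSpace ℂ (HomModel F₁ F₂) := inferInstanceAs (NormedSpace ℂ (F₁ →L[ℂ] F₂))

end HomModel

variable (E₁ E₂ : X → Type*)
  [∀ x, AddCommGroup (E₁ x)] [∀ x, Module ℂ (E₁ x)] [∀ x, TopologicalSpace (E₁ x)]
  [∀ x, AddCommGroup (E₂ x)] [∀ x, Module ℂ (E₂ x)] [∀ x, TopologicalSpace (E₂ x)]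

/-- The bundle `Hom(E₁, E₂)`: Mathlib's vector bundle of continuous linear maps, under a name of
its own. -/
def HomBundle (x : X) : Type _ := E₁ x →L[ℂ] E₂ x

namespace HomBundle

instance (x : X) : FunLike (HomBundle E₁ E₂ x) (E₁ x) (E₂ x) :=
  inferInstanceAs (FunLike (E₁ x →L[ℂ] E₂ x) (E₁ x) (E₂ x))

instance (x : X) : ContinuousLinearMapClass (HomBundle E₁ E₂ x) ℂ (E₁ x) (E₂ x) :=
  inferInstanceAs (ContinuousLinearMapClass (E₁ x →L[ℂ] E₂ x) ℂ (E₁ x) (E₂ x))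

variable [∀ x, IsTopologicalAddGroup (E₂ x)] [∀ x, ContinuousSMul ℂ (E₂ x)]

instance (x : X) : AddCommGroup (HomBundle E₁ E₂ x) :=
  inferInstanceAs (AddCommGroup (E₁ x →L[ℂ] E₂ x))

instance (x : X) : Module ℂ (HomBundle E₁ E₂ x) :=
  inferInstanceAs (Module ℂ (E₁ x →L[ℂ] E₂ x))

instance (x : X) : TopologicalSpace (HomBundle E₁ E₂ x) :=
  inferInstanceAs (TopologicalSpace (E₁ x →L[ℂ] E₂ x))

instance (x : X) : IsTopologicalAddGroup (HomBundle E₁ E₂ x) :=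
  inferInstanceAs (IsTopologicalAddGroup (E₁ x →L[ℂ] E₂ x))

instance (x : X) : ContinuousSMul ℂ (HomBundle E₁ E₂ x) :=
  inferInstanceAs (ContinuousSMul ℂ (E₁ x →L[ℂ] E₂ x))

variable {F₁ F₂ : Type*} [NormedAddCommGroup F₁] [NormedSpace ℂ F₁]
  [NormedAddCommGroup F₂] [NormedSpace ℂ F₂]
  [TopologicalSpace (TotalSpace F₁ E₁)] [FiberBundle F₁ E₁] [VectorBundle ℂ F₁ E₁]
  [TopologicalSpace (TotalSpace F₂ E₂)] [FiberBundle F₂ E₂] [VectorBundle ℂ F₂ E₂]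

instance : TopologicalSpace (TotalSpace (HomModel F₁ F₂) (HomBundle E₁ E₂)) :=
  inferInstanceAs (TopologicalSpace (TotalSpace (F₁ →L[ℂ] F₂) (fun x => E₁ x →L[ℂ] E₂ x)))

instance : FiberBundle (HomModel F₁ F₂) (HomBundle E₁ E₂) :=
  inferInstanceAs (FiberBundle (F₁ →L[ℂ] F₂) (fun x => E₁ x →L[ℂ] E₂ x))

instance : VectorBundle ℂ (HomModel F₁ F₂) (HomBundle E₁ E₂) :=
  inferInstanceAs (VectorBundle ℂ (F₁ →L[ℂ] F₂) (fun x => E₁ x →L[ℂ] E₂ x))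

instance [ChartedSpace ℂ X] [ContMDiffVectorBundle ω F₁ E₁ 𝓘(ℂ)]
    [ContMDiffVectorBundle ω F₂ E₂ 𝓘(ℂ)] :
    ContMDiffVectorBundle ω (HomModel F₁ F₂) (HomBundle E₁ E₂) 𝓘(ℂ) :=
  inferInstanceAs
    (ContMDiffVectorBundle ω (F₁ →L[ℂ] F₂) (fun x => E₁ x →L[ℂ] E₂ x) 𝓘(ℂ))

end HomBundle

end Hom

/-- The dual `L⁻¹ = Hom(L, 𝒪)` of a line bundle `L`. -/
abbrev DualBundle (L : X → Type*) [∀ x, AddCommGroup (L x)] [∀ x, Module ℂ (L x)]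
    [∀ x, TopologicalSpace (L x)] : X → Type _ :=
  HomBundle L (Trivial X ℂ)

variable [ChartedSpace ℂ X]

/-- The bundle `E ⊗ K = Hom(TX, E)`, where `K` is the holomorphic cotangent bundle of `X`. -/
abbrev CotangentTwist (E : X → Type*) [∀ x, AddCommGroup (E x)] [∀ x, Module ℂ (E x)]
    [∀ x, TopologicalSpace (E x)] : X → Type _ :=
  HomBundle (fun x : X => TangentSpace 𝓘(ℂ) x) E

/-- The space `H⁰(E)` of holomorphic sections of `E` (over `ℂ`, the smoothness class `ω` means
holomorphic). -/
abbrev HolomorphicSection (F : Type*) [NormedAddCommGroup F] [NormedSpace ℂ F]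
    (E : X → Type*) [TopologicalSpace (TotalSpace F E)] [∀ x, TopologicalSpace (E x)]
    [FiberBundle F E] : Type _ :=
  ContMDiffSection 𝓘(ℂ) F ω E

/-- `H⁰(Hom(E₁, E₂) ⊗ K)`, the holomorphic `1`-forms on `X` with values in `Hom(E₁, E₂)`. -/
abbrev HomForm (F₁ F₂ : Type*) [NormedAddCommGroup F₁] [NormedSpace ℂ F₁]
    [NormedAddCommGroup F₂] [NormedSpace ℂ F₂] [IsManifold 𝓘(ℂ) ω X]
    (E₁ E₂ : X → Type*)
    [∀ x, AddCommGroup (E₁ x)] [∀ x, Module ℂ (E₁ x)] [∀ x, TopologicalSpace (E₁ x)]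
    [∀ x, AddCommGroup (E₂ x)] [∀ x, Module ℂ (E₂ x)] [∀ x, TopologicalSpace (E₂ x)]
    [∀ x, IsTopologicalAddGroup (E₂ x)] [∀ x, ContinuousSMul ℂ (E₂ x)]
    [TopologicalSpace (TotalSpace F₁ E₁)] [FiberBundle F₁ E₁] [VectorBundle ℂ F₁ E₁]
    [TopologicalSpace (TotalSpace F₂ E₂)] [FiberBundle F₂ E₂] [VectorBundle ℂ F₂ E₂] : Type _ :=
  HolomorphicSection (HomModel ℂ (HomModel F₁ F₂)) (CotangentTwist (HomBundle E₁ E₂))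

section Degree

variable (F : Type*) [NormedAddCommGroup F] [NormedSpace ℂ F]
  {E : X → Type*} [TopologicalSpace (TotalSpace F E)]
  [∀ x, TopologicalSpace (E x)] [FiberBundle F E]

/-- The expression of a section `σ` of `E` in the preferred coordinate of `X` and the preferred
trivialization of `E` around `p`. -/
def localExpr (σ : (x : X) → E x) (p : X) : ℂ → F :=
  fun z => (trivializationAt F E p
    (TotalSpace.mk' F ((chartAt ℂ p).symm z) (σ ((chartAt ℂ p).symm z)))).2

/-- The vanishing order at `p` of a meromorphic section `σ` of `E` (negative at a pole, `⊤` if `σ`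
vanishes identically near `p`). -/
def sectionOrder (σ : (x : X) → E x) (p : X) : WithTop ℤ :=
  meromorphicOrderAt (localExpr F σ p) (chartAt ℂ p p)

/-- `σ` is a meromorphic section of `E` that vanishes identically on no nonempty open set. (The
values at the poles are irrelevant.) On a connected `X` these are the nonzero meromorphic
sections. -/
def IsNonzeroMeromorphicSection (σ : (x : X) → E x) : Prop :=
  ∀ p : X, MeromorphicAt (localExpr F σ p) (chartAt ℂ p p) ∧ sectionOrder F σ p ≠ ⊤

variable [∀ x, AddCommGroup (E x)] [∀ x, Module ℂ (E x)]

/-- `S` is a holomorphic line subbundle of `E`: locally it is spanned by a nowhere vanishing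
holomorphic section of `E`. -/
def IsLineSubbundle (S : (x : X) → Submodule ℂ (E x)) : Prop :=
  ∀ p : X, ∃ U : Set X, IsOpen U ∧ p ∈ U ∧ ∃ s : (x : X) → E x,
    ContMDiffOn 𝓘(ℂ) (𝓘(ℂ).prod 𝓘(ℂ, F)) ω (fun x => TotalSpace.mk' F x (s x)) U ∧
    ∀ x ∈ U, s x ≠ 0 ∧ S x = Submodule.span ℂ {s x}

/-- The holomorphic line subbundle `S` of `E` has degree `d`: `d` is the degree of the divisor of a
nonzero meromorphic section of `S`. Since `S` is a subbundle, the order of a section does not depend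
on whether it is regarded as a section of `S` or of `E`. On a compact connected `X` the divisor is
finite, `S` has nonzero meromorphic sections, and they all give the same `d`. -/
def HasDegree (S : (x : X) → Submodule ℂ (E x)) (d : ℤ) : Prop :=
  ∃ σ : (x : X) → E x, (∀ x, σ x ∈ S x) ∧ IsNonzeroMeromorphicSection F σ ∧
    ∑ᶠ p : X, (sectionOrder F σ p).untop₀ = d

end Degree

/-- The line bundle `L` has degree `d`. -/
def LineBundleHasDegree (L : X → Type*) [TopologicalSpace (TotalSpace ℂ L)]
    [∀ x, AddCommGroup (L x)] [∀ x, Module ℂ (L x)] [∀ x, TopologicalSpace (L x)]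
    [FiberBundle ℂ L] (d : ℤ) : Prop :=
  HasDegree ℂ (fun x => (⊤ : Submodule ℂ (L x))) d

section Stability

variable (F : Type*) [NormedAddCommGroup F] [NormedSpace ℂ F]
  {E : X → Type*} [TopologicalSpace (TotalSpace F E)]
  [∀ x, AddCommGroup (E x)] [∀ x, Module ℂ (E x)] [∀ x, TopologicalSpace (E x)]
  [FiberBundle F E]

/-- The subspaces `S x` of the fibres are preserved by the `End E`-valued `1`-form `Φ`. -/
def IsInvariant (Φ : (x : X) → TangentSpace 𝓘(ℂ) x →ₗ[ℂ] Module.End ℂ (E x))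
    (S : (x : X) → Submodule ℂ (E x)) : Prop :=
  ∀ (x : X) (v : TangentSpace 𝓘(ℂ) x), ∀ e ∈ S x, Φ x v e ∈ S x

/-- Stability of a Higgs bundle `(E, Φ)` of rank two with trivial determinant: every `Φ`-invariant
holomorphic line subbundle of `E` has negative degree. -/
def IsStable (Φ : (x : X) → TangentSpace 𝓘(ℂ) x →ₗ[ℂ] Module.End ℂ (E x)) : Prop :=
  ∀ S : (x : X) → Submodule ℂ (E x), IsLineSubbundle F S → IsInvariant Φ S →
    ∃ d : ℤ, d < 0 ∧ HasDegree F S d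

/-- Polystability of a Higgs bundle `(E, Φ)` of rank two with trivial determinant: it is a direct
sum of stable Higgs bundles of degree zero, that is, it is itself stable or it is the direct sum of
two Higgs line bundles of degree zero (Higgs line bundles are always stable). -/
def IsPolystable (Φ : (x : X) → TangentSpace 𝓘(ℂ) x →ₗ[ℂ] Module.End ℂ (E x)) : Prop :=
  IsStable F Φ ∨ ∃ S₁ S₂ : (x : X) → Submodule ℂ (E x),
    (IsLineSubbundle F S₁ ∧ IsInvariant Φ S₁ ∧ HasDegree F S₁ 0) ∧
    (IsLineSubbundle F S₂ ∧ IsInvariant Φ S₂ ∧ HasDegree F S₂ 0) ∧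
    ∀ x, IsCompl (S₁ x) (S₂ x)

/-- Strictly polystable: polystable but not stable. -/
def IsStrictlyPolystable (Φ : (x : X) → TangentSpace 𝓘(ℂ) x →ₗ[ℂ] Module.End ℂ (E x)) : Prop :=
  IsPolystable F Φ ∧ ¬ IsStable F Φ

end Stability

section OffDiagonal

variable [IsManifold 𝓘(ℂ) ω X]
  {L : X → Type*} [TopologicalSpace (TotalSpace ℂ L)]
  [∀ x, AddCommGroup (L x)] [∀ x, Module ℂ (L x)] [∀ x, TopologicalSpace (L x)]
  [∀ x, IsTopologicalAddGroup (L x)] [∀ x, ContinuousSMul ℂ (L x)]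
  [FiberBundle ℂ L] [VectorBundle ℂ ℂ L]

/-- The Higgs field with rows `(0, α)` and `(β, 0)` on `L ⊕ L⁻¹`, for
`α ∈ H⁰(L²K) = H⁰(Hom(L⁻¹, L) ⊗ K)` and `β ∈ H⁰(L⁻²K) = H⁰(Hom(L, L⁻¹) ⊗ K)`. -/
def offDiagonal (α : HomForm (HomModel ℂ ℂ) ℂ (DualBundle L) L)
    (β : HomForm ℂ (HomModel ℂ ℂ) L (DualBundle L)) (x : X) :
    TangentSpace 𝓘(ℂ) x →ₗ[ℂ] Module.End ℂ ((L ×ᵇ DualBundle L) x) :=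
  LinearMap.mk₂ ℂ (fun v e => (α x v e.2, β x v e.1))
    (fun v w e => by
      rw [map_add (α x), map_add (β x)]; rfl)
    (fun c v e => by
      rw [map_smul (α x), map_smul (β x)]; rfl)
    (fun v e f => Prod.ext (map_add (α x v) e.2 f.2) (map_add (β x v) e.1 f.1))
    (fun c v e => Prod.ext (map_smul (α x v) c e.2) (map_smul (β x v) c e.1))

/-- `α ∈ H⁰(L²K)` and `β ∈ H⁰(L⁻²K)` are proportional: there is a holomorphic isomorphism
`ψ : L → L⁻¹` (that is, a trivialization of `L²`) such that, under the identifications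
`L²K ≅ K ≅ L⁻²K` induced by `ψ`, one of them is a constant multiple of the other. The composite
identification sends `α : L⁻¹ → LK` to `ψ ∘ α ∘ ψ : L → L⁻¹K`. -/
def Proportional (α : HomForm (HomModel ℂ ℂ) ℂ (DualBundle L) L)
    (β : HomForm ℂ (HomModel ℂ ℂ) L (DualBundle L)) : Prop :=
  ∃ ψ : HolomorphicSection (HomModel ℂ (HomModel ℂ ℂ)) (HomBundle L (DualBundle L)),
    (∀ x, Function.Bijective (ψ x)) ∧
    ((∃ k : ℂ, ∀ (x : X) (v : TangentSpace 𝓘(ℂ) x) (l : L x),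
        ψ x (α x v (ψ x l)) = k • β x v l) ∨
      ∃ k : ℂ, ∀ (x : X) (v : TangentSpace 𝓘(ℂ) x) (l : L x),
        β x v l = k • ψ x (α x v (ψ x l)))

end OffDiagonal

end HiggsSurface

end

/-!
Two facts about line bundles on a compact connected Riemann surface carry the proof.

**The degree is well defined.** Two nonzero meromorphic sections of a line subbundle differ by a
meromorphic function, so `HasDegree.unique` amounts to the vanishing of the degree of a principal
divisor, `finsum_fnOrder_eq_zero`. For that, let `N(f)` be the number of zeros minus the number of
poles of `f`. Near a pole of `f`, the order of `f - t` does not depend on `t`; near a zero of order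
`k`, the function `f` is the `k`-th power of a local coordinate, and `w ^ k = t` has `k` small
solutions. Hence `N(f - t)` is locally constant in `t ∈ ℂ`, and `N(f) = N(f - 1)` if `f` is not
constant. Applied to `1 / f`, and with `1 / f - 1 = -(f - 1) / f`, this gives
`-N(f) = N(1 / f - 1) = N(f - 1) - N(f) = 0`.

**Nonzero maps do not lower the degree.** If a line subbundle `S` has a nonzero holomorphic map `η`
to a line bundle of degree `d`, then `η⁻¹` turns a meromorphic section of the target into one of
`S`, and its divisor is smaller by the zeros of `η`. So `deg S ≤ d`, with equality only if `η` has
no zeros (`HasDegree.exists_le_of_map`).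

Now let `S ⊆ L ⊕ L⁻¹` be an invariant line subbundle, with `α` and `β` both nonzero. If one of the
projections of `S` to `L` and `L⁻¹` vanished, then `S` would be one of the two summands near some
point, and invariance would force `α` or `β` to vanish there, hence everywhere by the identity
theorem. So both projections are nonzero maps to bundles of degree `0`, and `deg S ≤ 0`. If the
degree is `0`, both projections are isomorphisms, and `S` is the graph of an isomorphism
`ψ : L → L⁻¹`; invariance says `ψ α ψ = β`, and `α` and `β` are proportional
(`exists_iso_of_not_isStable`). In this case `-ψ` satisfies the same equation, and `L ⊕ L⁻¹` is the
direct sum of the graphs of `ψ` and `-ψ`, which are invariant of degree `0`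
(`isPolystable_of_ne_zero`).

If `α = 0`, the summand `L⁻¹` is invariant of degree `0`, and if `β = 0`, the summand `L` is; so
`(E, Φ)` is not stable as soon as one of them vanishes. If both vanish, `L ⊕ L⁻¹` is itself a
decomposition. If exactly one does, `Φ` is a nonzero nilpotent at some point, where its kernel is
the only invariant line, and `(E, Φ)` is not a direct sum of two invariant line subbundles.
-/

/-! ### Conservation of zeros minus poles in one variable -/

open Filter Topology Set Polynomial in
theorem Polynomial.meromorphicOrderAt_eval {P : ℂ[X]} (hP : P ≠ 0) (w : ℂ) :
    meromorphicOrderAt (fun z => P.eval z) w = (P.rootMultiplicity w : ℤ) := by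
  have hmero : MeromorphicAt (fun z => P.eval z) w :=
    (AnalyticOnNhd.eval_polynomial P w trivial).meromorphicAt
  obtain ⟨Q, hQ, hdvd⟩ := P.exists_eq_pow_rootMultiplicity_mul_and_not_dvd hP w
  refine (meromorphicOrderAt_eq_int_iff hmero).2 ⟨fun z => Q.eval z,
    AnalyticOnNhd.eval_polynomial Q w trivial, ?_, ?_⟩
  · rwa [Ne, ← Polynomial.IsRoot.def, ← dvd_iff_isRoot]
  · refine Filter.Eventually.of_forall fun z => ?_
    conv_lhs => rw [hQ]
    simp

namespace HiggsSurface

open Filter Topology Set Polynomial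

/-- The equation `w ^ k = t` has `k` solutions in the ball of radius `r` when `‖t‖ < r ^ k`, counted
with multiplicity: `ℂ` is algebraically closed, and all solutions lie in that ball. -/
theorem finsum_meromorphicOrderAt_pow_sub {k : ℕ} (hk : 0 < k) {t : ℂ} {r : ℝ} (hr : 0 < r)
    (ht : ‖t‖ < r ^ k) :
    ({w ∈ Metric.ball (0 : ℂ) r |
        (meromorphicOrderAt (fun w : ℂ => w ^ k - t) w).untop₀ ≠ 0}).Finite ∧
      ∑ᶠ w ∈ Metric.ball (0 : ℂ) r, (meromorphicOrderAt (fun w : ℂ => w ^ k - t) w).untop₀ = k := by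
  classical
  set P : ℂ[X] := X ^ k - C t with hPdef
  have hP : P ≠ 0 := X_pow_sub_C_ne_zero hk t
  have hord : ∀ w, (meromorphicOrderAt (fun w : ℂ => w ^ k - t) w).untop₀
      = (P.rootMultiplicity w : ℤ) := fun w => by
    have := P.meromorphicOrderAt_eval hP w
    simp only [hPdef, eval_sub, eval_pow, eval_X, eval_C] at this
    rw [this]; rfl
  have hball : ∀ w, P.rootMultiplicity w ≠ 0 → w ∈ Metric.ball (0 : ℂ) r := by
    intro w hw
    have hroot : P.IsRoot w := (rootMultiplicity_pos hP).1 (Nat.pos_of_ne_zero hw)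
    have : w ^ k = t := by
      simpa [hPdef, sub_eq_zero] using hroot
    rw [mem_ball_zero_iff]
    rw [← this, norm_pow] at ht
    exact lt_of_pow_lt_pow_left₀ k hr.le ht
  have hsupp : ∀ w, P.rootMultiplicity w ≠ 0 → w ∈ P.roots.toFinset := by
    intro w hw
    rw [Multiset.mem_toFinset, mem_roots hP]
    exact (rootMultiplicity_pos hP).1 (Nat.pos_of_ne_zero hw)
  simp only [hord]
  constructor
  · refine P.roots.toFinset.finite_toSet.subset ?_
    rintro w ⟨-, hw⟩
    exact hsupp w (by exact_mod_cast hw)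
  · rw [finsum_mem_eq_sum_of_inter_support_eq (t := P.roots.toFinset)]
    · simp only [← count_roots]
      rw [← Nat.cast_sum, Multiset.toFinset_sum_count_eq,
        IsAlgClosed.card_roots_eq_natDegree, hPdef, natDegree_X_pow_sub_C]
    · ext w
      simp only [mem_inter_iff, Function.mem_support, Finset.mem_coe]
      constructor
      · rintro ⟨-, hw⟩
        exact ⟨hsupp w (by exact_mod_cast hw), hw⟩
      · rintro ⟨-, hw⟩
        exact ⟨hball w (by exact_mod_cast hw), hw⟩

/-- Near a zero of order `k > 0`, an analytic function is the `k`-th power of a local coordinate. -/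
theorem exists_eq_pow_of_analyticOrderAt {f : ℂ → ℂ} {z₀ : ℂ} {k : ℕ} (hk : 0 < k)
    (hf : AnalyticAt ℂ f z₀) (hord : analyticOrderAt f z₀ = k) :
    ∃ h : ℂ → ℂ, AnalyticAt ℂ h z₀ ∧ h z₀ = 0 ∧ deriv h z₀ ≠ 0 ∧
      ∀ᶠ z in 𝓝 z₀, f z = h z ^ k := by
  obtain ⟨g, hg, hg0, hfg⟩ := (hf.analyticOrderAt_eq_natCast).1 hord
  -- A `k`-th root of the nonvanishing function `g` near `z₀`, from the logarithm of `g / g z₀`.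
  obtain ⟨c, hc⟩ := IsAlgClosed.exists_pow_nat_eq (g z₀) hk
  have hc0 : c ≠ 0 := by
    rintro rfl
    rw [zero_pow hk.ne'] at hc
    exact hg0 hc.symm
  set u : ℂ → ℂ := fun z => c * Complex.exp (Complex.log (g z / g z₀) / k) with hu
  have hu_an : AnalyticAt ℂ u z₀ := by
    have h1 : AnalyticAt ℂ (fun z => g z / g z₀) z₀ := hg.div analyticAt_const hg0
    have h2 : AnalyticAt ℂ (fun z => Complex.log (g z / g z₀)) z₀ :=
      h1.clog (by simp [div_self hg0])
    exact analyticAt_const.mul (h2.div analyticAt_const (by exact_mod_cast hk.ne')).cexp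
  have hu0 : u z₀ ≠ 0 := by simp [hu, hc0]
  have hupow : ∀ᶠ z in 𝓝 z₀, u z ^ k = g z := by
    filter_upwards [hg.continuousAt.eventually_ne hg0] with z hz
    have hk' : (k : ℂ) ≠ 0 := by exact_mod_cast hk.ne'
    rw [hu]
    simp only
    rw [mul_pow, hc, ← Complex.exp_nat_mul, mul_div_cancel₀ _ hk',
      Complex.exp_log (div_ne_zero hz hg0), mul_div_cancel₀ _ hg0]
  refine ⟨fun z => (z - z₀) * u z, by fun_prop, by simp, ?_, ?_⟩
  · have h1 : HasDerivAt (fun z => (z - z₀) * u z) (1 * u z₀ + (z₀ - z₀) * deriv u z₀) z₀ :=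
      ((hasDerivAt_id z₀).sub_const z₀).mul hu_an.differentiableAt.hasDerivAt
    rw [h1.deriv]
    simpa using hu0
  · filter_upwards [hfg, hupow] with z hz hz'
    rw [hz, mul_pow, hz', smul_eq_mul]

theorem meromorphicOrderAt_sub_const_of_neg {f : ℂ → ℂ} {z : ℂ} (hf : meromorphicOrderAt f z < 0)
    (t : ℂ) : meromorphicOrderAt (fun w => f w - t) z = meromorphicOrderAt f z := by
  have h0 : (0 : WithTop ℤ) ≤ meromorphicOrderAt (fun _ : ℂ => -t) z :=
    AnalyticAt.meromorphicOrderAt_nonneg analyticAt_const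
  have := meromorphicOrderAt_add_eq_left_of_lt (f₁ := f) (f₂ := fun _ => -t) (x := z)
    (MeromorphicAt.const _ _) (hf.trans_le h0)
  rw [← this]
  simp [sub_eq_add_neg, Pi.add_def]

theorem _root_.AnalyticAt.meromorphicOrderAt_eq_zero {f : ℂ → ℂ} {z : ℂ} (hf : AnalyticAt ℂ f z)
    (h0 : f z ≠ 0) : meromorphicOrderAt f z = 0 := by
  rw [hf.meromorphicOrderAt_eq, hf.analyticOrderAt_eq_zero.2 h0]
  rfl

/-- A property that holds near `y₀` except possibly at `y₀` holds near every nearby `y` except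
possibly at `y`. -/
theorem eventually_eventually_nhdsNE {Y : Type*} [TopologicalSpace Y] [T1Space Y] {P : Y → Prop}
    {y₀ : Y} (h : ∀ᶠ y in 𝓝[≠] y₀, P y) : ∀ᶠ y in 𝓝 y₀, ∀ᶠ w in 𝓝[≠] y, P w := by
  rw [eventually_nhdsWithin_iff] at h
  filter_upwards [eventually_eventually_nhds.2 h] with y hy
  rcases eq_or_ne y y₀ with rfl | hne
  · exact eventually_nhdsWithin_iff.2 hy
  · filter_upwards [nhdsWithin_le_nhds hy,
      nhdsWithin_le_nhds (isOpen_ne.mem_nhds hne)] with w hw hw' using hw hw'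

/-- Where a meromorphic function has order zero, nearby translates have no zeros and no poles
nearby. -/
theorem eventually_meromorphicOrderAt_sub_eq_zero {f : ℂ → ℂ} {z₀ : ℂ} (hf : MeromorphicAt f z₀)
    (h0 : meromorphicOrderAt f z₀ = 0) :
    ∃ ε > 0, ∀ᶠ z in 𝓝 z₀, ∀ t : ℂ, ‖t‖ < ε → meromorphicOrderAt (fun w => f w - t) z = 0 := by
  obtain ⟨g, hg, hfg⟩ := hf.meromorphicOrderAt_nonneg_iff.1 h0.ge
  have hg0 : g z₀ ≠ 0 := by
    intro h
    rw [meromorphicOrderAt_congr hfg, hg.meromorphicOrderAt_eq] at h0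
    have h1 := (hg.analyticOrderAt_ne_zero).2 h
    cases h2 : analyticOrderAt g z₀ with
    | top => simp [h2] at h0
    | coe n =>
      rw [h2] at h0 h1
      have : ((n : ℤ) : WithTop ℤ) = 0 := h0
      norm_cast at this
      exact h1 (by simp [this])
  refine ⟨‖g z₀‖ / 2, by positivity, ?_⟩
  have hev : ∀ᶠ z in 𝓝 z₀, ‖g z₀‖ / 2 < ‖g z‖ :=
    hg.continuousAt.norm.eventually_const_lt (by linarith [norm_pos_iff.2 hg0])
  filter_upwards [hev, hg.eventually_analyticAt, eventually_eventually_nhdsNE hfg]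
    with z hz hgz hfgz t ht
  have h1 : (fun w => f w - t) =ᶠ[𝓝[≠] z] fun w => g w - t := by
    filter_upwards [hfgz] with w hw
    rw [hw]
  rw [meromorphicOrderAt_congr h1]
  refine (hgz.sub analyticAt_const).meromorphicOrderAt_eq_zero fun h => ?_
  rw [sub_eq_zero.1 h] at hz
  exact lt_asymm hz ht

/-- **Local conservation of the number of zeros minus poles**: if `f` is meromorphic and not
identically zero near `z₀`, then in a small neighbourhood of `z₀` the orders of `f - t`, for `t`
small, add up to the order of `f` at `z₀`. -/
theorem exists_finsum_meromorphicOrderAt_sub_eq {f : ℂ → ℂ} {z₀ : ℂ} (hf : MeromorphicAt f z₀)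
    (htop : meromorphicOrderAt f z₀ ≠ ⊤) {V : Set ℂ} (hV : V ∈ 𝓝 z₀) :
    ∃ U ⊆ V, IsOpen U ∧ z₀ ∈ U ∧ ∃ ε > 0, ∀ t : ℂ, ‖t‖ < ε →
      {z ∈ U | (meromorphicOrderAt (fun w => f w - t) z).untop₀ ≠ 0}.Finite ∧
      ∑ᶠ z ∈ U, (meromorphicOrderAt (fun w => f w - t) z).untop₀
        = (meromorphicOrderAt f z₀).untop₀ := by
  classical
  rcases lt_trichotomy (meromorphicOrderAt f z₀) 0 with hneg | hzero | hpos
  · -- At a pole the order of `f - t` does not depend on `t`, and `f` is large nearby.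
    have hlarge : ∀ᶠ z in 𝓝[≠] z₀, 1 < ‖f z‖ :=
      (tendsto_norm_cobounded_atTop.comp
        (tendsto_cobounded_of_meromorphicOrderAt_neg hneg)).eventually_gt_atTop 1
    have han : ∀ᶠ z in 𝓝[≠] z₀, AnalyticAt ℂ f z := hf.eventually_analyticAt
    have hev := (eventually_nhdsWithin_iff.1 (hlarge.and han)).and hV
    obtain ⟨U, hU, hUo, hzU⟩ := eventually_nhds_iff.1 hev
    have hoff : ∀ t : ℂ, ‖t‖ < 1 → ∀ z ∈ U, z ≠ z₀ →
        meromorphicOrderAt (fun w => f w - t) z = 0 := by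
      intro t ht z hz hne
      obtain ⟨h1, h2⟩ := (hU z hz).1 hne
      refine (h2.sub analyticAt_const).meromorphicOrderAt_eq_zero fun h => ?_
      rw [sub_eq_zero.1 h] at h1
      exact lt_asymm h1 ht
    refine ⟨U, fun z hz => (hU z hz).2, hUo, hzU, 1, one_pos, fun t ht => ⟨?_, ?_⟩⟩
    · refine (finite_singleton z₀).subset fun z hz => ?_
      by_contra hne
      exact hz.2 (by rw [hoff t ht z hz.1 hne]; rfl)
    · rw [finsum_eq_single _ z₀]
      · rw [finsum_eq_if, if_pos hzU, meromorphicOrderAt_sub_const_of_neg hneg]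
      · intro z hne
        rw [finsum_eq_if]
        split_ifs with hz
        · rw [hoff t ht z hz hne]; rfl
        · rfl
  · obtain ⟨ε, hε, hev⟩ := eventually_meromorphicOrderAt_sub_eq_zero hf hzero
    obtain ⟨U, hU, hUo, hzU⟩ := eventually_nhds_iff.1 (hev.and hV)
    have h0 : ∀ t : ℂ, ‖t‖ < ε → ∀ z ∈ U,
        (meromorphicOrderAt (fun w => f w - t) z).untop₀ = 0 := fun t ht z hz => by
      rw [(hU z hz).1 t ht]; rfl
    refine ⟨U, fun z hz => (hU z hz).2, hUo, hzU, ε, hε, fun t ht => ⟨?_, ?_⟩⟩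
    · convert finite_empty
      ext z
      simp only [mem_ofPred_eq, mem_empty_iff_false, iff_false, not_and, not_not]
      exact h0 t ht z
    · rw [finsum_mem_congr rfl (h0 t ht), finsum_mem_zero, hzero]
      rfl
  · -- At a zero of order `k` the function is `h ^ k` for a local coordinate `h`.
    obtain ⟨g, hg, hfg⟩ := hf.meromorphicOrderAt_nonneg_iff.1 hpos.le
    rw [meromorphicOrderAt_congr hfg] at hpos htop ⊢
    obtain ⟨k, hk⟩ : ∃ k : ℕ, analyticOrderAt g z₀ = k := by
      refine ENat.ne_top_iff_exists.1 (fun h => htop ?_) |>.imp fun _ h => h.symm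
      rw [hg.meromorphicOrderAt_eq, h]; rfl
    have hgk : meromorphicOrderAt g z₀ = (k : ℤ) := by
      rw [hg.meromorphicOrderAt_eq, hk]; rfl
    have hkpos : 0 < k := by
      rw [hgk] at hpos
      exact_mod_cast hpos
    obtain ⟨h, hh, hh0, hh', hpow⟩ := exists_eq_pow_of_analyticOrderAt hkpos hg hk
    have hstrict : HasStrictDerivAt h (deriv h z₀) z₀ := hh.hasStrictDerivAt
    set e : OpenPartialHomeomorph ℂ ℂ :=
      (hstrict.hasStrictFDerivAt_equiv hh').toOpenPartialHomeomorph h with he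
    have hez : z₀ ∈ e.source :=
      (hstrict.hasStrictFDerivAt_equiv hh').mem_toOpenPartialHomeomorph_source
    have hecoe : ∀ z, e z = h z := fun z => rfl
    have hfpow : ∀ᶠ z in 𝓝[≠] z₀, f z = h z ^ k := by
      filter_upwards [hfg, nhdsWithin_le_nhds hpow] with z h1 h2 using h1.trans h2
    have hder : ∀ᶠ z in 𝓝 z₀, deriv h z ≠ 0 := hh.deriv.continuousAt.eventually_ne hh'
    obtain ⟨W, hW, hWo, hzW⟩ := eventually_nhds_iff.1
      (((eventually_eventually_nhdsNE hfpow).and hder).and (hh.eventually_analyticAt.and hV))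
    obtain ⟨r, hr, hball⟩ : ∃ r > 0, Metric.ball (0 : ℂ) r ⊆ e.target ∩ e.symm ⁻¹' W := by
      refine Metric.mem_nhds_iff.1 (Filter.inter_mem ?_ ?_)
      · exact e.open_target.mem_nhds (by rw [← hh0]; exact e.map_source hez)
      · have h1 : (0 : ℂ) = e z₀ := hh0.symm
        rw [h1]
        refine (e.symm.continuousAt (e.map_source hez)).preimage_mem_nhds ?_
        rw [e.left_inv hez]
        exact hWo.mem_nhds hzW
    set U : Set ℂ := e.source ∩ e ⁻¹' Metric.ball 0 r with hUdef
    have hUo : IsOpen U := e.isOpen_inter_preimage Metric.isOpen_ball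
    have hUW : U ⊆ W := fun z hz => by
      have := (hball hz.2).2
      rwa [mem_preimage, e.left_inv hz.1] at this
    have hbij : BijOn h U (Metric.ball 0 r) := by
      refine ⟨fun z hz => hz.2, e.injOn.mono inter_subset_left, fun w hw => ?_⟩
      refine ⟨e.symm w, ⟨e.map_target (hball hw).1, ?_⟩, e.right_inv (hball hw).1⟩
      rw [mem_preimage, e.right_inv (hball hw).1]
      exact hw
    have hcomp : ∀ t, ∀ z ∈ U, meromorphicOrderAt (fun w => f w - t) z
        = meromorphicOrderAt (fun w : ℂ => w ^ k - t) (h z) := by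
      intro t z hz
      obtain ⟨⟨h1, h2⟩, h3, -⟩ := hW z (hUW hz)
      rw [← meromorphicOrderAt_comp_of_deriv_ne_zero h3 h2]
      refine meromorphicOrderAt_congr ?_
      filter_upwards [h1] with w hw
      simp [hw]
    refine ⟨U, fun z hz => (hW z (hUW hz)).2.2, hUo, ⟨hez, ?_⟩, r ^ k, by positivity,
      fun t ht => ?_⟩
    · rw [mem_preimage, hecoe, hh0]
      exact Metric.mem_ball_self hr
    obtain ⟨hfin, hsum⟩ := finsum_meromorphicOrderAt_pow_sub hkpos hr ht
    constructor
    · refine Set.Finite.of_finite_image (f := h) (hfin.subset ?_)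
        (hbij.injOn.mono fun z hz => hz.1)
      rintro _ ⟨z, ⟨hz, hz'⟩, rfl⟩
      exact ⟨hbij.mapsTo hz, by rwa [← hcomp t z hz]⟩
    · rw [finsum_mem_eq_of_bijOn h hbij (g := fun w =>
        (meromorphicOrderAt (fun w : ℂ => w ^ k - t) w).untop₀)
        (fun z hz => by rw [hcomp t z hz]), hsum, hgk]
      rfl

end HiggsSurface

namespace HiggsSurface

open Filter Topology Set

/-! ### Orders of meromorphic functions on a Riemann surface -/

/-- A subset of a compact space without accumulation points is finite. -/
theorem finite_of_eventually_nhdsNE {Y : Type*} [TopologicalSpace Y] [CompactSpace Y]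
    {P : Y → Prop}
    (h : ∀ p, ∀ᶠ q in 𝓝[≠] p, ¬ P q) : {p | P p}.Finite := by
  refine isCompact_univ.induction_on (p := fun s => (s ∩ {p | P p}).Finite) (by simp)
    (fun s t hst ht => ht.subset (inter_subset_inter_left _ hst))
    (fun s t hs ht => by rw [union_inter_distrib_right]; exact hs.union ht) (fun p _ => ?_)
    |>.subset (by simp)
  refine ⟨{q | q ≠ p → ¬ P q}, ?_, (finite_singleton p).subset ?_⟩
  · rw [nhdsWithin_univ]
    exact eventually_nhdsWithin_iff.1 (h p)
  · rintro q ⟨hq, hq'⟩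
    by_contra hne
    exact hq hne hq'

section FunctionOrder

variable {X : Type*} [TopologicalSpace X] [ChartedSpace ℂ X]

/-- `f : X → ℂ` is meromorphic at `p`, expressed in the preferred coordinate around `p`. The value of
`f` at `p` is irrelevant. -/
def FnMeromorphicAt (f : X → ℂ) (p : X) : Prop :=
  MeromorphicAt (fun z => f ((chartAt ℂ p).symm z)) (chartAt ℂ p p)

/-- The order of vanishing of `f : X → ℂ` at `p`, in the preferred coordinate around `p`. -/
noncomputable def fnOrder (f : X → ℂ) (p : X) : WithTop ℤ :=
  meromorphicOrderAt (fun z => f ((chartAt ℂ p).symm z)) (chartAt ℂ p p)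

theorem eventually_nhds_chart {p : X} {P : X → Prop} :
    (∀ᶠ z in 𝓝 (chartAt ℂ p p), P ((chartAt ℂ p).symm z)) ↔ ∀ᶠ q in 𝓝 p, P q :=
  (chartAt ℂ p).eventually_nhds' P (mem_chart_source ℂ p)

theorem eventually_nhdsNE_chart_of_mem {p q : X} (hq : q ∈ (chartAt ℂ p).source) {P : X → Prop} :
    (∀ᶠ z in 𝓝[≠] (chartAt ℂ p q), P ((chartAt ℂ p).symm z)) ↔ ∀ᶠ q' in 𝓝[≠] q, P q' := by
  rw [eventually_nhdsWithin_iff, eventually_nhdsWithin_iff,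
    ← (chartAt ℂ p).eventually_nhds' _ hq]
  refine eventually_congr ?_
  filter_upwards [(chartAt ℂ p).open_target.mem_nhds ((chartAt ℂ p).map_source hq)] with z hz
  have : z ≠ chartAt ℂ p q ↔ (chartAt ℂ p).symm z ≠ q := by
    rw [not_iff_not]
    constructor
    · rintro rfl
      exact (chartAt ℂ p).left_inv hq
    · rintro rfl
      exact ((chartAt ℂ p).right_inv hz).symm
  simp only [mem_compl_iff, mem_singleton_iff]
  exact imp_congr_left this

theorem eventually_nhdsNE_chart {p : X} {P : X → Prop} :
    (∀ᶠ z in 𝓝[≠] (chartAt ℂ p p), P ((chartAt ℂ p).symm z)) ↔ ∀ᶠ q in 𝓝[≠] p, P q :=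
  eventually_nhdsNE_chart_of_mem (mem_chart_source ℂ p)

theorem fnOrder_congr {f g : X → ℂ} {p : X} (h : ∀ᶠ q in 𝓝[≠] p, f q = g q) :
    fnOrder f p = fnOrder g p :=
  meromorphicOrderAt_congr (eventually_nhdsNE_chart.2 h)

theorem FnMeromorphicAt.congr {f g : X → ℂ} {p : X} (hf : FnMeromorphicAt f p)
    (h : ∀ᶠ q in 𝓝[≠] p, f q = g q) : FnMeromorphicAt g p :=
  MeromorphicAt.congr hf (eventually_nhdsNE_chart.2 h)

theorem fnOrder_eq_top_iff {f : X → ℂ} {p : X} :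
    fnOrder f p = ⊤ ↔ ∀ᶠ q in 𝓝[≠] p, f q = 0 := by
  rw [fnOrder, meromorphicOrderAt_eq_top_iff, eventually_nhdsNE_chart (P := fun q => f q = 0)]

theorem fnOrder_ne_top_iff {f : X → ℂ} {p : X} (hf : FnMeromorphicAt f p) :
    fnOrder f p ≠ ⊤ ↔ ∀ᶠ q in 𝓝[≠] p, f q ≠ 0 := by
  rw [fnOrder, meromorphicOrderAt_ne_top_iff_eventually_ne_zero hf,
    eventually_nhdsNE_chart (P := fun q => f q ≠ 0)]

theorem FnMeromorphicAt.sub_const {f : X → ℂ} {p : X} (hf : FnMeromorphicAt f p) (t : ℂ) :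
    FnMeromorphicAt (fun x => f x - t) p :=
  MeromorphicAt.fun_sub hf (MeromorphicAt.const _ _)

theorem FnMeromorphicAt.inv {f : X → ℂ} {p : X} (hf : FnMeromorphicAt f p) :
    FnMeromorphicAt (fun x => (f x)⁻¹) p :=
  MeromorphicAt.fun_inv hf

theorem FnMeromorphicAt.mul {f g : X → ℂ} {p : X} (hf : FnMeromorphicAt f p)
    (hg : FnMeromorphicAt g p) : FnMeromorphicAt (fun x => f x * g x) p :=
  MeromorphicAt.fun_mul hf hg

theorem fnOrder_inv {f : X → ℂ} {p : X} : fnOrder (fun x => (f x)⁻¹) p = - fnOrder f p :=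
  meromorphicOrderAt_inv (f := fun z => f ((chartAt ℂ p).symm z))

theorem fnOrder_mul {f g : X → ℂ} {p : X} (hf : FnMeromorphicAt f p) (hg : FnMeromorphicAt g p) :
    fnOrder (fun x => f x * g x) p = fnOrder f p + fnOrder g p :=
  meromorphicOrderAt_mul hf hg

theorem eventuallyEq_comp_chart_transition (f : X → ℂ) {p q : X} (hq : q ∈ (chartAt ℂ p).source) :
    (fun z => f ((chartAt ℂ q).symm z)) =ᶠ[𝓝 (chartAt ℂ q q)]
      (fun z => f ((chartAt ℂ p).symm z)) ∘ (fun z => chartAt ℂ p ((chartAt ℂ q).symm z)) := by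
  have := eventually_nhds_chart (p := q)
    (P := fun x => f x = f ((chartAt ℂ p).symm (chartAt ℂ p x)))
  refine this.2 ?_
  filter_upwards [(chartAt ℂ p).open_source.mem_nhds hq] with x hx
  rw [(chartAt ℂ p).left_inv hx]

variable [IsManifold 𝓘(ℂ) ω X]

theorem analyticAt_chart_transition {p q x : X} (hp : x ∈ (chartAt ℂ p).source)
    (hq : x ∈ (chartAt ℂ q).source) :
    AnalyticAt ℂ (fun z => chartAt ℂ p ((chartAt ℂ q).symm z)) (chartAt ℂ q x) := by
  have h1 : ContMDiffAt 𝓘(ℂ) 𝓘(ℂ) ω (chartAt ℂ q).symm (chartAt ℂ q x) :=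
    contMDiffAt_symm_of_mem_maximalAtlas (IsManifold.chart_mem_maximalAtlas q)
      ((chartAt ℂ q).map_source hq)
  have h2 : ContMDiffAt 𝓘(ℂ) 𝓘(ℂ) ω (chartAt ℂ p) ((chartAt ℂ q).symm (chartAt ℂ q x)) := by
    rw [(chartAt ℂ q).left_inv hq]
    exact contMDiffAt_of_mem_maximalAtlas (IsManifold.chart_mem_maximalAtlas p) hp
  exact (contMDiffAt_iff_contDiffAt.1 (h2.comp _ h1)).analyticAt

theorem deriv_chart_transition_ne_zero {p q x : X} (hp : x ∈ (chartAt ℂ p).source)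
    (hq : x ∈ (chartAt ℂ q).source) :
    deriv (fun z => chartAt ℂ p ((chartAt ℂ q).symm z)) (chartAt ℂ q x) ≠ 0 := by
  have h1 := (analyticAt_chart_transition hp hq).differentiableAt.hasDerivAt
  have h2 := (analyticAt_chart_transition hq hp).differentiableAt.hasDerivAt
  have hx : chartAt ℂ p ((chartAt ℂ q).symm (chartAt ℂ q x)) = chartAt ℂ p x := by
    rw [(chartAt ℂ q).left_inv hq]
  rw [← hx] at h2
  have h3 := h2.comp (chartAt ℂ q x) h1
  have h4 : (fun z => chartAt ℂ q ((chartAt ℂ p).symm z)) ∘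
      (fun z => chartAt ℂ p ((chartAt ℂ q).symm z)) =ᶠ[𝓝 (chartAt ℂ q x)] id := by
    have hc : ContinuousAt (chartAt ℂ q).symm (chartAt ℂ q x) :=
      (chartAt ℂ q).symm.continuousAt ((chartAt ℂ q).map_source hq)
    have hnhds : (chartAt ℂ p).source ∈ 𝓝 ((chartAt ℂ q).symm (chartAt ℂ q x)) := by
      rw [(chartAt ℂ q).left_inv hq]
      exact (chartAt ℂ p).open_source.mem_nhds hp
    filter_upwards [hc.preimage_mem_nhds hnhds,
      (chartAt ℂ q).open_target.mem_nhds ((chartAt ℂ q).map_source hq)] with z hz hz'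
    simp only [Function.comp_apply, id_eq]
    rw [(chartAt ℂ p).left_inv hz, (chartAt ℂ q).right_inv hz']
  have h5 := h3.unique ((hasDerivAt_id _).congr_of_eventuallyEq h4)
  intro h0
  rw [h0, mul_zero] at h5
  exact zero_ne_one h5

/-- The order may be computed in any chart. -/
theorem fnOrder_eq_of_mem (f : X → ℂ) {p q : X} (hq : q ∈ (chartAt ℂ p).source) :
    fnOrder f q = meromorphicOrderAt (fun z => f ((chartAt ℂ p).symm z)) (chartAt ℂ p q) := by
  have hqq := mem_chart_source ℂ q
  have h := meromorphicOrderAt_comp_of_deriv_ne_zero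
    (f := fun z => f ((chartAt ℂ p).symm z))
    (analyticAt_chart_transition hq hqq) (deriv_chart_transition_ne_zero hq hqq)
  rw [(chartAt ℂ q).left_inv hqq] at h
  rw [← h, fnOrder]
  exact meromorphicOrderAt_congr
    ((eventuallyEq_comp_chart_transition f hq).filter_mono nhdsWithin_le_nhds)

theorem eventually_fnOrder_eq_zero {f : X → ℂ} {p : X} (hf : FnMeromorphicAt f p)
    (htop : fnOrder f p ≠ ⊤) : ∀ᶠ q in 𝓝[≠] p, fnOrder f q = 0 := by
  have h1 := MeromorphicAt.eventually_analyticAt hf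
  have h2 := (meromorphicOrderAt_ne_top_iff_eventually_ne_zero hf).1 htop
  have h3 : ∀ᶠ z in 𝓝[≠] (chartAt ℂ p p), fnOrder f ((chartAt ℂ p).symm z) = 0 := by
    filter_upwards [h1, h2, nhdsWithin_le_nhds ((chartAt ℂ p).open_target.mem_nhds
      ((chartAt ℂ p).map_source (mem_chart_source ℂ p)))] with z hz hz' hzt
    rw [fnOrder_eq_of_mem f ((chartAt ℂ p).map_target hzt), (chartAt ℂ p).right_inv hzt]
    exact hz.meromorphicOrderAt_eq_zero hz'
  exact eventually_nhdsNE_chart.1 h3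

/-- The identity theorem for meromorphic functions. -/
theorem isClopen_fnOrder_eq_top [T1Space X] {f : X → ℂ} (hf : ∀ p, FnMeromorphicAt f p) :
    IsClopen {p | fnOrder f p = ⊤} := by
  constructor
  · rw [← isOpen_compl_iff, isOpen_iff_mem_nhds]
    intro p hp
    filter_upwards [eventually_nhdsWithin_iff.1 (eventually_fnOrder_eq_zero (hf p) hp)]
      with q hq
    rcases eq_or_ne q p with rfl | hne
    · exact hp
    · change fnOrder f q ≠ ⊤
      rw [hq hne]
      exact WithTop.zero_ne_top
  · rw [isOpen_iff_mem_nhds]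
    intro p hp
    filter_upwards [eventually_eventually_nhdsNE (fnOrder_eq_top_iff.1 hp)] with q hq
    exact fnOrder_eq_top_iff.2 hq

theorem fnOrder_ne_top_of_exists [T1Space X] [PreconnectedSpace X] {f : X → ℂ}
    (hf : ∀ p, FnMeromorphicAt f p) {p₀ : X} (hp₀ : fnOrder f p₀ ≠ ⊤) (p : X) :
    fnOrder f p ≠ ⊤ := by
  rcases isClopen_iff.1 (isClopen_fnOrder_eq_top hf) with h | h
  · intro hp
    exact (h ▸ hp : p ∈ (∅ : Set X))
  · exact absurd (h ▸ mem_univ p₀ : p₀ ∈ {p | fnOrder f p = ⊤}) hp₀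

theorem finite_fnOrder_ne_zero [CompactSpace X] {f : X → ℂ} (hf : ∀ p, FnMeromorphicAt f p)
    (hne : ∀ p, fnOrder f p ≠ ⊤) : {p | (fnOrder f p).untop₀ ≠ 0}.Finite :=
  finite_of_eventually_nhdsNE fun p => by
    filter_upwards [eventually_fnOrder_eq_zero (hf p) (hne p)] with q hq
    rw [hq]; simp

/-- The local conservation law `exists_finsum_meromorphicOrderAt_sub_eq`, on a Riemann surface. -/
theorem exists_finsum_fnOrder_sub_eq {f : X → ℂ} {p : X} (hf : FnMeromorphicAt f p)
    (htop : fnOrder f p ≠ ⊤) {V : Set X} (hV : V ∈ 𝓝 p) :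
    ∃ U ⊆ V, IsOpen U ∧ p ∈ U ∧ ∃ ε > 0, ∀ t : ℂ, ‖t‖ < ε →
      {q ∈ U | (fnOrder (fun x => f x - t) q).untop₀ ≠ 0}.Finite ∧
      ∑ᶠ q ∈ U, (fnOrder (fun x => f x - t) q).untop₀ = (fnOrder f p).untop₀ := by
  set c := chartAt ℂ p with hc
  have hp : p ∈ c.source := mem_chart_source ℂ p
  have hV' : c.target ∩ c.symm ⁻¹' V ∈ 𝓝 (c p) := by
    refine inter_mem (c.open_target.mem_nhds (c.map_source hp)) ?_
    refine (c.symm.continuousAt (c.map_source hp)).preimage_mem_nhds ?_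
    rwa [c.left_inv hp]
  obtain ⟨U, hUV, hUo, hpU, ε, hε, h⟩ := exists_finsum_meromorphicOrderAt_sub_eq hf htop hV'
  have hbij : BijOn c (c.source ∩ c ⁻¹' U) U := by
    refine ⟨fun q hq => hq.2, c.injOn.mono inter_subset_left, fun z hz => ?_⟩
    refine ⟨c.symm z, ⟨c.map_target (hUV hz).1, ?_⟩, c.right_inv (hUV hz).1⟩
    rw [mem_preimage, c.right_inv (hUV hz).1]
    exact hz
  refine ⟨c.source ∩ c ⁻¹' U, fun q hq => ?_, c.isOpen_inter_preimage hUo, ⟨hp, hpU⟩, ε, hε,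
    fun t ht => ⟨?_, ?_⟩⟩
  · have := (hUV hq.2).2
    rwa [mem_preimage, c.left_inv hq.1] at this
  · refine Set.Finite.of_finite_image (f := c) ((h t ht).1.subset ?_)
      (hbij.injOn.mono fun z hz => hz.1)
    rintro _ ⟨q, ⟨hq, hq'⟩, rfl⟩
    exact ⟨hq.2, by rwa [fnOrder_eq_of_mem _ hq.1] at hq'⟩
  · rw [finsum_mem_eq_of_bijOn c hbij (g := fun z =>
      (meromorphicOrderAt (fun w => f (c.symm w) - t) z).untop₀)
      (fun q hq => by rw [fnOrder_eq_of_mem _ hq.1])]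
    exact (h t ht).2

theorem exists_eventually_fnOrder_sub_eq_zero {f : X → ℂ} {p : X} (hf : FnMeromorphicAt f p)
    (h0 : fnOrder f p = 0) :
    ∃ ε > 0, ∀ᶠ q in 𝓝 p, ∀ t : ℂ, ‖t‖ < ε → fnOrder (fun x => f x - t) q = 0 := by
  obtain ⟨ε, hε, h⟩ := eventually_meromorphicOrderAt_sub_eq_zero hf h0
  refine ⟨ε, hε, eventually_nhds_chart.1 ?_⟩
  filter_upwards [h, (chartAt ℂ p).open_target.mem_nhds
      ((chartAt ℂ p).map_source (mem_chart_source ℂ p))] with z hz hzt t ht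
  rw [fnOrder_eq_of_mem _ ((chartAt ℂ p).map_target hzt), (chartAt ℂ p).right_inv hzt]
  exact hz t ht

variable [T2Space X] [CompactSpace X]

/-- The number of zeros minus the number of poles of `f - t` does not change for small `t`. -/
theorem eventually_finsum_fnOrder_sub_eq {f : X → ℂ} (hf : ∀ p, FnMeromorphicAt f p)
    (hne : ∀ p, fnOrder f p ≠ ⊤) :
    ∀ᶠ t in 𝓝 (0 : ℂ), ∑ᶠ p, (fnOrder (fun x => f x - t) p).untop₀
      = ∑ᶠ p, (fnOrder f p).untop₀ := by
  set Z : Set X := {p | (fnOrder f p).untop₀ ≠ 0} with hZ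
  have hZfin : Z.Finite := finite_fnOrder_ne_zero hf hne
  obtain ⟨V, hV, hVdisj⟩ := hZfin.t2_separation
  choose U hUV hUo hpU ε hε hsum using fun p =>
    exists_finsum_fnOrder_sub_eq (hf p) (hne p) ((hV p).2.mem_nhds (hV p).1)
  have hK : IsCompact (⋃ p ∈ Z, U p)ᶜ :=
    (isOpen_biUnion fun p _ => hUo p).isClosed_compl.isCompact
  -- Off the zeros and poles of `f`, compactness gives a uniform bound on `t`.
  obtain ⟨δ, hδ, hoff⟩ : ∃ δ > 0, ∀ q ∈ (⋃ p ∈ Z, U p)ᶜ, ∀ t : ℂ, ‖t‖ < δ →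
      fnOrder (fun x => f x - t) q = 0 := by
    refine hK.induction_on (p := fun s => ∃ δ > 0, ∀ q ∈ s, ∀ t : ℂ, ‖t‖ < δ →
      fnOrder (fun x => f x - t) q = 0) ⟨1, one_pos, by simp⟩ ?_ ?_ ?_
    · rintro s s' hss ⟨δ, hδ, h⟩
      exact ⟨δ, hδ, fun q hq => h q (hss hq)⟩
    · rintro s s' ⟨δ, hδ, h⟩ ⟨δ', hδ', h'⟩
      refine ⟨min δ δ', lt_min hδ hδ', ?_⟩
      rintro q (hq | hq) t ht
      · exact h q hq t (ht.trans_le (min_le_left _ _))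
      · exact h' q hq t (ht.trans_le (min_le_right _ _))
    · intro p hp
      have hpZ : p ∉ Z := fun hpZ => hp (mem_biUnion hpZ (hpU p))
      have h0 : fnOrder f p = 0 := by
        rw [hZ, mem_ofPred_eq, not_not, WithTop.untop₀_eq_zero] at hpZ
        exact hpZ.resolve_right (hne p)
      obtain ⟨δ, hδ, h⟩ := exists_eventually_fnOrder_sub_eq_zero (hf p) h0
      exact ⟨_, nhdsWithin_le_nhds h, δ, hδ, fun q hq => hq⟩
  have hεev : ∀ᶠ t in 𝓝 (0 : ℂ), ∀ p ∈ Z, ‖t‖ < ε p := by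
    rw [eventually_all_finite hZfin]
    intro p _
    filter_upwards [Metric.ball_mem_nhds (0 : ℂ) (hε p)] with t ht using mem_ball_zero_iff.1 ht
  have hδev : ∀ᶠ t in 𝓝 (0 : ℂ), ‖t‖ < δ := by
    filter_upwards [Metric.ball_mem_nhds (0 : ℂ) hδ] with t ht using mem_ball_zero_iff.1 ht
  filter_upwards [hεev, hδev] with t ht htδ
  set N : X → ℤ := fun q => (fnOrder (fun x => f x - t) q).untop₀ with hN
  have h1 : ∑ᶠ q, N q = ∑ᶠ q ∈ ⋃ p ∈ Z, U p ∩ Function.support N, N q := by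
    rw [← finsum_mem_univ, finsum_mem_inter_support_eq' N univ (⋃ p ∈ Z, U p ∩ Function.support N)]
    intro q hq
    simp only [mem_univ, true_iff, mem_iUnion, mem_inter_iff]
    by_contra hcon
    push Not at hcon
    refine hq ?_
    have : q ∈ (⋃ p ∈ Z, U p)ᶜ := by
      simp only [mem_compl_iff, mem_iUnion, not_exists]
      exact fun p hp hqU => hcon p hp hqU hq
    simp only [hN, hoff q this t htδ, WithTop.untop₀_zero]
  have hfin : ∀ p ∈ Z, (U p ∩ Function.support N).Finite := fun p hp => (hsum p t (ht p hp)).1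
  rw [h1, finsum_mem_biUnion (hVdisj.mono fun p => inter_subset_left.trans (hUV p)) hZfin hfin]
  simp only [finsum_mem_inter_support]
  rw [finsum_mem_congr rfl (fun p hp => (hsum p t (ht p hp)).2)]
  exact finsum_mem_support fun p => (fnOrder f p).untop₀

/-- For a nonconstant `f`, the number of zeros minus poles of `f - t` is independent of `t`. -/
theorem finsum_fnOrder_sub_eq {f : X → ℂ} (hf : ∀ p, FnMeromorphicAt f p)
    (hne : ∀ t : ℂ, ∀ p, fnOrder (fun x => f x - t) p ≠ ⊤) (t : ℂ) :
    ∑ᶠ p, (fnOrder (fun x => f x - t) p).untop₀ = ∑ᶠ p, (fnOrder f p).untop₀ := by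
  have hloc : IsLocallyConstant fun t : ℂ => ∑ᶠ p, (fnOrder (fun x => f x - t) p).untop₀ := by
    rw [IsLocallyConstant.iff_eventually_eq]
    intro t₀
    have h1 := eventually_finsum_fnOrder_sub_eq (fun p => (hf p).sub_const t₀) (hne t₀)
    have h2 : Tendsto (fun t : ℂ => t - t₀) (𝓝 t₀) (𝓝 0) := by
      have : ContinuousAt (fun t : ℂ => t - t₀) t₀ := by fun_prop
      simpa [ContinuousAt] using this
    filter_upwards [h2.eventually h1] with s hs
    rw [← hs]
    simp
  have := hloc.apply_eq_of_preconnectedSpace t 0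
  simpa using this

/-- **The degree of a principal divisor is zero**: a nonzero meromorphic function on a compact
connected Riemann surface has as many zeros as poles. -/
theorem finsum_fnOrder_eq_zero [PreconnectedSpace X] {f : X → ℂ} (hf : ∀ p, FnMeromorphicAt f p)
    (hne : ∀ p, fnOrder f p ≠ ⊤) : ∑ᶠ p, (fnOrder f p).untop₀ = 0 := by
  have hsub : ∀ t : ℂ, ∀ p, FnMeromorphicAt (fun x => f x - t) p := fun t p => (hf p).sub_const t
  by_cases hconst : ∃ t : ℂ, ∃ p, fnOrder (fun x => f x - t) p = ⊤
  · -- Here `f` is constant off a discrete set.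
    obtain ⟨t, p₀, hp₀⟩ := hconst
    have hall : ∀ p, fnOrder (fun x => f x - t) p = ⊤ := by
      intro p
      by_contra hp
      exact fnOrder_ne_top_of_exists (hsub t) hp p₀ hp₀
    have hev : ∀ p, ∀ᶠ q in 𝓝[≠] p, f q = t := fun p => by
      filter_upwards [fnOrder_eq_top_iff.1 (hall p)] with q hq using sub_eq_zero.1 hq
    have ht : t ≠ 0 := by
      rintro rfl
      exact hne p₀ (fnOrder_eq_top_iff.2 (hev p₀))
    have h0 : ∀ p, (fnOrder f p).untop₀ = 0 := fun p => by
      rw [fnOrder_congr (hev p), fnOrder,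
        (analyticAt_const (v := t)).meromorphicOrderAt_eq_zero ht]
      simp
    simp [h0]
  · push Not at hconst
    have hinv : ∀ p, FnMeromorphicAt (fun x => (f x)⁻¹) p := fun p => (hf p).inv
    -- Away from the zeros of `f`, `1/f - s = -s (f - 1/s) / f`.
    have hinvord : ∀ s : ℂ, s ≠ 0 → ∀ p, fnOrder (fun x => (f x)⁻¹ - s) p
        = fnOrder (fun x => f x - s⁻¹) p + - fnOrder f p := by
      intro s hs p
      have h1 : ∀ᶠ q in 𝓝[≠] p, (f q)⁻¹ - s = ((-s) * (f q - s⁻¹)) * (f q)⁻¹ := by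
        filter_upwards [(fnOrder_ne_top_iff (hf p)).1 (hne p)] with q hq
        field_simp
        ring
      have hs' : FnMeromorphicAt (fun _ : X => -s) p := MeromorphicAt.const _ _
      rw [fnOrder_congr h1, fnOrder_mul (hs'.mul (hsub s⁻¹ p)) (hinv p),
        fnOrder_mul hs' (hsub s⁻¹ p), fnOrder_inv]
      have : fnOrder (fun _ : X => -s) p = 0 :=
        (analyticAt_const (v := -s)).meromorphicOrderAt_eq_zero (neg_ne_zero.2 hs)
      rw [this, zero_add]
    have hnegtop : ∀ p, - fnOrder f p ≠ ⊤ := fun p h => hne p (by simpa using h)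
    have hinvne : ∀ s : ℂ, ∀ p, fnOrder (fun x => (f x)⁻¹ - s) p ≠ ⊤ := by
      intro s p
      rcases eq_or_ne s 0 with rfl | hs
      · simp only [sub_zero, fnOrder_inv]
        exact hnegtop p
      · rw [hinvord s hs p]
        exact WithTop.add_ne_top.2 ⟨hconst _ p, hnegtop p⟩
    -- Comparing the counts for `1/f` and `1/f - 1` with those for `f` and `f - 1`.
    have h1 := finsum_fnOrder_sub_eq hinv hinvne 1
    have h2 : ∑ᶠ p, (fnOrder (fun x => (f x)⁻¹ - 1) p).untop₀ = 0 := by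
      have : ∀ p, (fnOrder (fun x => (f x)⁻¹ - 1) p).untop₀
          = (fnOrder (fun x => f x - 1) p).untop₀ - (fnOrder f p).untop₀ := fun p => by
        have := hinvord 1 one_ne_zero p
        rw [inv_one] at this
        rw [this, WithTop.untop₀_add (hconst 1 p) (hnegtop p), WithTop.untop₀_neg, sub_eq_add_neg]
      simp only [this]
      rw [finsum_sub_distrib (finite_fnOrder_ne_zero (hsub 1) (hconst 1))
        (finite_fnOrder_ne_zero hf hne), finsum_fnOrder_sub_eq hf hconst 1, sub_self]
    rw [h2] at h1
    simp only [fnOrder_inv, WithTop.untop₀_neg, finsum_neg_distrib] at h1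
    linarith

end FunctionOrder

/-! ### Sections of line subbundles and uniqueness of the degree -/

theorem eventually_mem_baseSet {Y : Type*} [TopologicalSpace Y] {F : Type*} [TopologicalSpace F]
    {E : Y → Type*} [TopologicalSpace (TotalSpace F E)] [∀ y, TopologicalSpace (E y)]
    [FiberBundle F E] (p : Y) : ∀ᶠ q in 𝓝 p, q ∈ (trivializationAt F E p).baseSet :=
  (trivializationAt F E p).open_baseSet.mem_nhds (mem_baseSet_trivializationAt F E p)

/-- A Riemann surface has no isolated points. -/
theorem nhdsNE_neBot {Y : Type*} [TopologicalSpace Y] [ChartedSpace ℂ Y] (p : Y) :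
    (𝓝[≠] p).NeBot := by
  rw [← eventually_false_iff_eq_bot.not.trans neBot_iff.symm,
    ← eventually_nhdsNE_chart (P := fun _ => False), eventually_false_iff_eq_bot]
  exact NeBot.ne inferInstance

section Sections

variable {X : Type*} [TopologicalSpace X] [ChartedSpace ℂ X]
  {F : Type*} [NormedAddCommGroup F] [NormedSpace ℂ F]
  {E : X → Type*} [TopologicalSpace (TotalSpace F E)] [∀ x, TopologicalSpace (E x)]
  [FiberBundle F E]

variable (F) in
/-- The section `s` of `E` is holomorphic at `p`. -/
abbrev HolomorphicSectionAt (s : (x : X) → E x) (p : X) : Prop :=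
  ContMDiffAt 𝓘(ℂ) (𝓘(ℂ).prod 𝓘(ℂ, F)) ω (fun x => TotalSpace.mk' F x (s x)) p

theorem HolomorphicSectionAt.analyticAt_localExpr [IsManifold 𝓘(ℂ) ω X]
    {s : (x : X) → E x} {p : X}
    (hs : HolomorphicSectionAt F s p) : AnalyticAt ℂ (localExpr F s p) (chartAt ℂ p p) := by
  rw [HolomorphicSectionAt, contMDiffAt_section] at hs
  have h1 : ContMDiffAt 𝓘(ℂ) 𝓘(ℂ) ω (chartAt ℂ p).symm (chartAt ℂ p p) :=
    contMDiffAt_symm_of_mem_maximalAtlas (IsManifold.chart_mem_maximalAtlas p)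
      ((chartAt ℂ p).map_source (mem_chart_source ℂ p))
  rw [← (chartAt ℂ p).left_inv (mem_chart_source ℂ p)] at hs
  have h2 := contMDiffAt_iff_contDiffAt.1 (hs.comp (chartAt ℂ p p) h1)
  rw [(chartAt ℂ p).left_inv (mem_chart_source ℂ p)] at h2
  exact h2.analyticAt

variable [∀ x, AddCommGroup (E x)] [∀ x, Module ℂ (E x)]

variable (F) in
/-- `s` is a local frame at `p` of a line subbundle: it is holomorphic and nonzero at `p`. -/
def IsFrameAt (s : (x : X) → E x) (p : X) : Prop :=
  HolomorphicSectionAt F s p ∧ s p ≠ 0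

theorem IsLineSubbundle.exists_frame {S : (x : X) → Submodule ℂ (E x)} (hS : IsLineSubbundle F S)
    (p : X) : ∃ s : (x : X) → E x,
      ∀ᶠ q in 𝓝 p, IsFrameAt F s q ∧ S q = Submodule.span ℂ {s q} := by
  obtain ⟨U, hUo, hpU, s, hs, hspan⟩ := hS p
  refine ⟨s, ?_⟩
  filter_upwards [hUo.mem_nhds hpU] with q hq
  exact ⟨⟨hs.contMDiffAt (hUo.mem_nhds hq), (hspan q hq).1⟩, (hspan q hq).2⟩

theorem isLineSubbundle_of_exists_frame {S : (x : X) → Submodule ℂ (E x)}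
    (h : ∀ p, ∃ s : (x : X) → E x,
      ∀ᶠ q in 𝓝 p, IsFrameAt F s q ∧ S q = Submodule.span ℂ {s q}) : IsLineSubbundle F S := by
  intro p
  obtain ⟨s, hs⟩ := h p
  obtain ⟨U, hU, hUo, hpU⟩ := eventually_nhds_iff.1 hs
  exact ⟨U, hUo, hpU, s, fun q hq => (hU q hq).1.1.contMDiffWithinAt,
    fun q hq => ⟨(hU q hq).1.2, (hU q hq).2⟩⟩

/-- The coefficient of a section with respect to a local frame, as a function on all of `X`; its
regularity is a separate matter, see `fnMeromorphicAt_of_frame`. -/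
theorem exists_coeff_of_frame {S : (x : X) → Submodule ℂ (E x)} {s σ : (x : X) → E x} {p : X}
    (hs : ∀ᶠ q in 𝓝 p, IsFrameAt F s q ∧ S q = Submodule.span ℂ {s q})
    (hσ : ∀ᶠ q in 𝓝 p, σ q ∈ S q) :
    ∃ g : X → ℂ, ∀ᶠ q in 𝓝 p, σ q = g q • s q := by
  have h : ∀ q, ∃ c : ℂ, σ q ∈ Submodule.span ℂ {s q} → σ q = c • s q := by
    intro q
    by_cases hq : σ q ∈ Submodule.span ℂ {s q}
    · obtain ⟨c, hc⟩ := Submodule.mem_span_singleton.1 hq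
      exact ⟨c, fun _ => hc.symm⟩
    · exact ⟨0, fun h => absurd h hq⟩
  choose g hg using h
  refine ⟨g, ?_⟩
  filter_upwards [hs, hσ] with q hq hσq using hg q (hq.2 ▸ hσq)

variable [VectorBundle ℂ F E]

theorem localExpr_apply_smul (s : (x : X) → E x) {p : X} {z : ℂ}
    (hz : (chartAt ℂ p).symm z ∈ (trivializationAt F E p).baseSet) {σ : (x : X) → E x} {c : ℂ}
    (h : σ ((chartAt ℂ p).symm z) = c • s ((chartAt ℂ p).symm z)) :
    localExpr F σ p z = c • localExpr F s p z := by
  rw [localExpr, localExpr, h]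
  exact ((trivializationAt F E p).linear ℂ hz).map_smul c _

theorem localExpr_eq_zero_iff (s : (x : X) → E x) {p : X} {z : ℂ}
    (hz : (chartAt ℂ p).symm z ∈ (trivializationAt F E p).baseSet) :
    localExpr F s p z = 0 ↔ s ((chartAt ℂ p).symm z) = 0 := by
  have h := ((trivializationAt F E p).continuousLinearEquivAt ℂ _ hz).map_eq_zero_iff
    (x := s ((chartAt ℂ p).symm z))
  rw [← h]
  rfl

theorem eventually_localExpr_eq_smul {s σ : (x : X) → E x} {g : X → ℂ} {p : X}
    (h : ∀ᶠ q in 𝓝[≠] p, σ q = g q • s q) :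
    localExpr F σ p =ᶠ[𝓝[≠] (chartAt ℂ p p)]
      (fun z => g ((chartAt ℂ p).symm z)) • localExpr F s p := by
  have h1 := eventually_nhdsNE_chart.2 (h.and
    (nhdsWithin_le_nhds (eventually_mem_baseSet (F := F) (E := E) p)))
  filter_upwards [h1] with z hz
  exact localExpr_apply_smul s hz.2 hz.1

theorem localExpr_self_eq_zero_iff (s : (x : X) → E x) (p : X) :
    localExpr F s p (chartAt ℂ p p) = 0 ↔ s p = 0 := by
  have hpp := (chartAt ℂ p).left_inv (mem_chart_source ℂ p)
  rw [localExpr_eq_zero_iff s (by rw [hpp]; exact mem_baseSet_trivializationAt F E p), hpp]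

theorem IsFrameAt.localExpr_ne_zero {s : (x : X) → E x} {p : X} (hs : IsFrameAt F s p) :
    localExpr F s p (chartAt ℂ p p) ≠ 0 :=
  (localExpr_self_eq_zero_iff s p).not.2 hs.2

variable [IsManifold 𝓘(ℂ) ω X]

theorem meromorphicAt_localExpr_of_frame {s σ : (x : X) → E x} {g : X → ℂ} {p : X}
    (hs : IsFrameAt F s p) (h : ∀ᶠ q in 𝓝[≠] p, σ q = g q • s q) (hg : FnMeromorphicAt g p) :
    MeromorphicAt (localExpr F σ p) (chartAt ℂ p p) :=
  (MeromorphicAt.smul hg hs.1.analyticAt_localExpr.meromorphicAt).congr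
    (eventually_localExpr_eq_smul h).symm

theorem sectionOrder_eq_fnOrder {s σ : (x : X) → E x} {g : X → ℂ} {p : X}
    (hs : IsFrameAt F s p) (h : ∀ᶠ q in 𝓝[≠] p, σ q = g q • s q) (hg : FnMeromorphicAt g p) :
    sectionOrder F σ p = fnOrder g p := by
  have han := hs.1.analyticAt_localExpr
  have h0 : meromorphicOrderAt (localExpr F s p) (chartAt ℂ p p) = 0 := by
    rw [han.meromorphicOrderAt_eq, han.analyticOrderAt_eq_zero.2 hs.localExpr_ne_zero]
    rfl
  rw [sectionOrder, meromorphicOrderAt_congr (eventually_localExpr_eq_smul h),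
    meromorphicOrderAt_smul hg han.meromorphicAt, h0, add_zero]
  rfl

/-- The coefficient with respect to a frame is recovered by a linear functional that does not vanish
on the frame. -/
theorem fnMeromorphicAt_of_frame {s σ : (x : X) → E x} {g : X → ℂ} {p : X}
    (hs : IsFrameAt F s p) (h : ∀ᶠ q in 𝓝[≠] p, σ q = g q • s q)
    (hσ : MeromorphicAt (localExpr F σ p) (chartAt ℂ p p)) : FnMeromorphicAt g p := by
  obtain ⟨φ, -, hφ⟩ := exists_dual_vector ℂ _ (norm_ne_zero_iff.2 hs.localExpr_ne_zero)
  have han := hs.1.analyticAt_localExpr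
  have hφs : AnalyticAt ℂ (fun z => φ (localExpr F s p z)) (chartAt ℂ p p) :=
    (φ.analyticAt _).comp han
  have hφσ : MeromorphicAt (fun z => φ (localExpr F σ p z)) (chartAt ℂ p p) := by
    obtain ⟨n, hn⟩ := hσ
    refine ⟨n, ?_⟩
    have := (φ.analyticAt _).comp hn
    refine this.congr (Eventually.of_forall fun z => ?_)
    simp
  have hne : φ (localExpr F s p (chartAt ℂ p p)) ≠ 0 := by
    rw [hφ]
    simpa using hs.localExpr_ne_zero
  refine (hφσ.div hφs.meromorphicAt).congr ?_
  filter_upwards [eventually_localExpr_eq_smul (F := F) h,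
    nhdsWithin_le_nhds (hφs.continuousAt.eventually_ne hne)] with z hz hz'
  rw [Pi.div_apply, hz]
  simp only [Pi.smul_apply', map_smul, smul_eq_mul]
  exact mul_div_cancel_right₀ _ hz'

/-- Around any point, a nonzero meromorphic section of a line subbundle is a local frame times a
meromorphic function, whose order is the order of the section. -/
theorem IsLineSubbundle.exists_coeff {S : (x : X) → Submodule ℂ (E x)} {s σ : (x : X) → E x}
    {p : X} (hs : ∀ᶠ q in 𝓝 p, IsFrameAt F s q ∧ S q = Submodule.span ℂ {s q})
    (hσ : ∀ x, σ x ∈ S x) (hmero : IsNonzeroMeromorphicSection F σ) :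
    ∃ g : X → ℂ, ∀ᶠ q in 𝓝 p, σ q = g q • s q ∧ FnMeromorphicAt g q ∧
      sectionOrder F σ q = fnOrder g q := by
  obtain ⟨g, hg⟩ := exists_coeff_of_frame hs (Eventually.of_forall hσ)
  refine ⟨g, ?_⟩
  filter_upwards [hs, hg, eventually_eventually_nhds.2 hg] with q hq hgq hgq'
  have h1 : ∀ᶠ q' in 𝓝[≠] q, σ q' = g q' • s q' := nhdsWithin_le_nhds hgq'
  have h2 := fnMeromorphicAt_of_frame hq.1 h1 (hmero q).1
  exact ⟨hgq, h2, sectionOrder_eq_fnOrder hq.1 h1 h2⟩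

theorem finite_sectionOrder_ne_zero [CompactSpace X] {S : (x : X) → Submodule ℂ (E x)}
    (hS : IsLineSubbundle F S) {σ : (x : X) → E x} (hσ : ∀ x, σ x ∈ S x)
    (hmero : IsNonzeroMeromorphicSection F σ) :
    {p | (sectionOrder F σ p).untop₀ ≠ 0}.Finite := by
  refine finite_of_eventually_nhdsNE fun p => ?_
  obtain ⟨s, hs⟩ := hS.exists_frame p
  obtain ⟨g, hg⟩ := IsLineSubbundle.exists_coeff hs hσ hmero
  obtain ⟨-, h1, h2⟩ := hg.self_of_nhds
  filter_upwards [nhdsWithin_le_nhds hg,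
    eventually_fnOrder_eq_zero h1 (h2 ▸ (hmero p).2)] with q hq hq0
  rw [hq.2.2, hq0]
  simp

/-- **The degree of a line subbundle is well defined**: the quotient of two nonzero meromorphic
sections is a meromorphic function, and its divisor has degree zero. -/
theorem HasDegree.unique [T2Space X] [CompactSpace X] [PreconnectedSpace X]
    {S : (x : X) → Submodule ℂ (E x)} (hS : IsLineSubbundle F S) {d d' : ℤ}
    (h : HasDegree F S d) (h' : HasDegree F S d') : d = d' := by
  classical
  obtain ⟨σ, hσ, hσm, rfl⟩ := h
  obtain ⟨τ, hτ, hτm, rfl⟩ := h'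
  -- `f` is the quotient `τ / σ`, with value `0` where `τ` is not a multiple of `σ`.
  have hex : ∀ x, ∃ c : ℂ, (∃ c' : ℂ, τ x = c' • σ x) → τ x = c • σ x := fun x => by
    by_cases hx : ∃ c' : ℂ, τ x = c' • σ x
    · exact ⟨hx.choose, fun _ => hx.choose_spec⟩
    · exact ⟨0, fun h => absurd h hx⟩
  choose f hf using hex
  have key : ∀ p, FnMeromorphicAt f p ∧
      fnOrder f p = sectionOrder F τ p + - sectionOrder F σ p := by
    intro p
    obtain ⟨s, hs⟩ := hS.exists_frame p
    obtain ⟨g, hg⟩ := IsLineSubbundle.exists_coeff hs hσ hσm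
    obtain ⟨k, hk⟩ := IsLineSubbundle.exists_coeff hs hτ hτm
    obtain ⟨-, hg1, hg2⟩ := hg.self_of_nhds
    obtain ⟨-, hk1, hk2⟩ := hk.self_of_nhds
    have hne := (fnOrder_ne_top_iff hg1).1 (hg2 ▸ (hσm p).2)
    have hfk : ∀ᶠ q in 𝓝[≠] p, k q * (g q)⁻¹ = f q := by
      filter_upwards [hne, nhdsWithin_le_nhds hg, nhdsWithin_le_nhds hk, nhdsWithin_le_nhds hs]
        with q h1 h2 h3 h4
      have h5 : τ q = (k q * (g q)⁻¹) • σ q := by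
        rw [h2.1, h3.1, smul_smul, inv_mul_cancel_right₀ h1]
      have h6 := hf q ⟨_, h5⟩
      have h7 : σ q ≠ 0 := by
        rw [h2.1]
        exact smul_ne_zero h1 h4.1.2
      rw [h5] at h6
      exact smul_left_injective ℂ h7 h6
    refine ⟨(hk1.mul hg1.inv).congr hfk, ?_⟩
    rw [← fnOrder_congr hfk, fnOrder_mul hk1 hg1.inv, fnOrder_inv, hg2, hk2]
  have hnegtop : ∀ p, - sectionOrder F σ p ≠ ⊤ := fun p h => (hσm p).2 (by simpa using h)
  have h0 := finsum_fnOrder_eq_zero (fun p => (key p).1) fun p => by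
    rw [(key p).2]
    exact WithTop.add_ne_top.2 ⟨(hτm p).2, hnegtop p⟩
  have h1 : ∀ p, (fnOrder f p).untop₀
      = (sectionOrder F τ p).untop₀ - (sectionOrder F σ p).untop₀ := fun p => by
    rw [(key p).2, WithTop.untop₀_add (hτm p).2 (hnegtop p), WithTop.untop₀_neg, sub_eq_add_neg]
  simp only [h1] at h0
  rw [finsum_sub_distrib (finite_sectionOrder_ne_zero hS hτ hτm)
    (finite_sectionOrder_ne_zero hS hσ hσm)] at h0
  linarith

/-- The identity theorem for holomorphic sections. -/
theorem eq_zero_of_eventually_eq_zero [PreconnectedSpace X] {σ : (x : X) → E x}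
    (hσ : ∀ p, HolomorphicSectionAt F σ p) {p₀ : X} (h : ∀ᶠ q in 𝓝[≠] p₀, σ q = 0) (x : X) :
    σ x = 0 := by
  have hloc : ∀ p, (∃ᶠ q in 𝓝[≠] p, σ q = 0) → ∀ᶠ q in 𝓝 p, σ q = 0 := by
    intro p hp
    have hev := eventually_mem_baseSet (F := F) (E := E) p
    have h1 : ∃ᶠ z in 𝓝[≠] (chartAt ℂ p p), localExpr F σ p z = 0 := by
      intro hcon
      refine hp (eventually_nhdsNE_chart.1 ?_)
      filter_upwards [hcon, eventually_nhdsNE_chart.2 (nhdsWithin_le_nhds hev)] with z hz hz' hz0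
      exact hz ((localExpr_eq_zero_iff σ hz').2 hz0)
    have h2 := (hσ p).analyticAt_localExpr.frequently_zero_iff_eventually_zero.1 h1
    refine eventually_nhds_chart.1 ?_
    filter_upwards [h2, eventually_nhds_chart.2 hev] with z hz hz'
    exact (localExpr_eq_zero_iff σ hz').1 hz
  have hclopen : IsClopen {p | ∀ᶠ q in 𝓝 p, σ q = 0} := by
    refine ⟨?_, isOpen_iff_mem_nhds.2 fun p hp => eventually_eventually_nhds.2 hp⟩
    rw [← isOpen_compl_iff, isOpen_iff_mem_nhds]
    intro p hp
    have h1 : ∀ᶠ q in 𝓝[≠] p, σ q ≠ 0 := by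
      by_contra hcon
      exact hp (hloc p fun hcon' => hcon hcon')
    filter_upwards [eventually_nhdsWithin_iff.1 h1] with q hq
    rcases eq_or_ne q p with rfl | hne
    · exact hp
    · exact fun hq0 => hq hne hq0.self_of_nhds
  rcases isClopen_iff.1 hclopen with h' | h'
  · have := nhdsNE_neBot p₀
    exact absurd (h' ▸ hloc p₀ h.frequently : p₀ ∈ (∅ : Set X)) (notMem_empty _)
  · exact (h' ▸ mem_univ x : x ∈ {p | ∀ᶠ q in 𝓝 p, σ q = 0}).self_of_nhds

end Sections

/-! ### Holomorphic maps of line subbundles -/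

section Maps

variable {X : Type*} [TopologicalSpace X] [ChartedSpace ℂ X]
  {F : Type*} [NormedAddCommGroup F] [NormedSpace ℂ F]
  {E : X → Type*} [TopologicalSpace (TotalSpace F E)] [∀ x, TopologicalSpace (E x)]
  [FiberBundle F E] [∀ x, AddCommGroup (E x)] [∀ x, Module ℂ (E x)]
  {G : Type*} [NormedAddCommGroup G] [NormedSpace ℂ G]
  {A : X → Type*} [TopologicalSpace (TotalSpace G A)] [∀ x, TopologicalSpace (A x)]
  [FiberBundle G A] [∀ x, AddCommGroup (A x)] [∀ x, Module ℂ (A x)]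

/-- The image of a line subbundle under an injective holomorphic bundle map. -/
theorem IsLineSubbundle.map {T : (x : X) → Submodule ℂ (A x)} (hT : IsLineSubbundle G T)
    {ι : (x : X) → A x →ₗ[ℂ] E x} (hinj : ∀ x, Function.Injective (ι x))
    (hι : ∀ (s : (x : X) → A x) (p : X), HolomorphicSectionAt G s p →
      HolomorphicSectionAt F (fun x => ι x (s x)) p) :
    IsLineSubbundle F (fun x => (T x).map (ι x)) := by
  refine isLineSubbundle_of_exists_frame fun p => ?_
  obtain ⟨s, hs⟩ := hT.exists_frame p
  refine ⟨fun x => ι x (s x), ?_⟩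
  filter_upwards [hs] with q hq
  refine ⟨⟨hι s q hq.1.1, ?_⟩, ?_⟩
  · rw [Ne, map_eq_zero_iff _ (hinj q)]
    exact hq.1.2
  · rw [hq.2, Submodule.map_span, image_singleton]

variable [VectorBundle ℂ F E]

/-- A bundle of rank one is a line subbundle of itself. -/
theorem isLineSubbundle_top [ContMDiffVectorBundle ω F E 𝓘(ℂ)] (hF : Module.finrank ℂ F = 1) :
    IsLineSubbundle F (fun x => (⊤ : Submodule ℂ (E x))) := by
  obtain ⟨f, hf, hspan⟩ := finrank_eq_one_iff'.1 hF
  refine isLineSubbundle_of_exists_frame fun p => ?_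
  set e := trivializationAt F E p with he
  refine ⟨fun x => e.symm x f, ?_⟩
  filter_upwards [eventually_mem_baseSet (F := F) (E := E) p] with q hq
  have hcoord : ∀ x ∈ e.baseSet, (e ⟨x, e.symm x f⟩).2 = f := fun x hx => by
    rw [e.apply_mk_symm hx]
  have hq0 : e.symm q f ≠ 0 := by
    intro h0
    have h1 := hcoord q hq
    rw [h0] at h1
    exact hf (h1.symm.trans (e.linear ℂ hq).map_zero)
  refine ⟨⟨?_, hq0⟩, ?_⟩
  · rw [HolomorphicSectionAt, e.contMDiffAt_section_iff hq]
    refine (contMDiffAt_const (c := f)).congr_of_eventuallyEq ?_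
    filter_upwards [e.open_baseSet.mem_nhds hq] with x hx using hcoord x hx
  · refine (Submodule.eq_top_iff'.2 fun v => ?_).symm
    obtain ⟨c, hc⟩ := hspan (e ⟨q, v⟩).2
    refine Submodule.mem_span_singleton.2 ⟨c, ?_⟩
    refine (e.continuousLinearEquivAt ℂ q hq).injective ?_
    rw [map_smul]
    change c • (e ⟨q, e.symm q f⟩).2 = (e ⟨q, v⟩).2
    rw [hcoord q hq, hc]

variable [VectorBundle ℂ G A] [IsManifold 𝓘(ℂ) ω X]

/-- An injective holomorphic bundle map takes local frames to local frames, so it preserves the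
orders of meromorphic sections. -/
theorem HasDegree.map {T : (x : X) → Submodule ℂ (A x)} (hT : IsLineSubbundle G T)
    {ι : (x : X) → A x →ₗ[ℂ] E x} (hinj : ∀ x, Function.Injective (ι x))
    (hι : ∀ (s : (x : X) → A x) (p : X), HolomorphicSectionAt G s p →
      HolomorphicSectionAt F (fun x => ι x (s x)) p) {d : ℤ} (h : HasDegree G T d) :
    HasDegree F (fun x => (T x).map (ι x)) d := by
  obtain ⟨σ, hσ, hσm, rfl⟩ := h
  have key : ∀ p, MeromorphicAt (localExpr F (fun x => ι x (σ x)) p) (chartAt ℂ p p) ∧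
      sectionOrder F (fun x => ι x (σ x)) p = sectionOrder G σ p := by
    intro p
    obtain ⟨s, hs⟩ := hT.exists_frame p
    obtain ⟨g, hg⟩ := IsLineSubbundle.exists_coeff hs hσ hσm
    obtain ⟨-, hg1, hg2⟩ := hg.self_of_nhds
    have hs' : IsFrameAt F (fun x => ι x (s x)) p :=
      ⟨hι s p hs.self_of_nhds.1.1, (map_eq_zero_iff _ (hinj p)).not.2 hs.self_of_nhds.1.2⟩
    have h1 : ∀ᶠ q in 𝓝[≠] p, ι q (σ q) = g q • ι q (s q) := by
      filter_upwards [nhdsWithin_le_nhds hg] with q hq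
      rw [hq.1, map_smul]
    exact ⟨meromorphicAt_localExpr_of_frame hs' h1 hg1,
      (sectionOrder_eq_fnOrder hs' h1 hg1).trans hg2.symm⟩
  refine ⟨fun x => ι x (σ x), fun x => Submodule.mem_map_of_mem (hσ x), fun p => ⟨(key p).1, ?_⟩,
    finsum_congr fun p => by rw [(key p).2]⟩
  rw [(key p).2]
  exact (hσm p).2

/-- A line subbundle `S` with a nonzero holomorphic map `η` to a line bundle `T` of degree `d₀` has
degree at most `d₀`, with equality only if the map is injective on every fibre: the preimage under
`η` of a meromorphic section of `T` is a meromorphic section of `S`, and its divisor is smaller by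
the divisor of zeros of `η`. -/
theorem HasDegree.exists_le_of_map [CompactSpace X]
    {S : (x : X) → Submodule ℂ (E x)} (hS : IsLineSubbundle F S)
    {T : (x : X) → Submodule ℂ (A x)} (hT : IsLineSubbundle G T)
    {η : (x : X) → E x →ₗ[ℂ] A x} (hηT : ∀ x, ∀ e ∈ S x, η x e ∈ T x)
    (hη : ∀ (s : (x : X) → E x) (p : X), HolomorphicSectionAt F s p →
      HolomorphicSectionAt G (fun x => η x (s x)) p)
    (hnz : ∀ p, ¬ ∀ᶠ q in 𝓝[≠] p, ∀ e ∈ S q, η q e = 0) {d₀ : ℤ} (h : HasDegree G T d₀) :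
    ∃ d, HasDegree F S d ∧ d ≤ d₀ ∧ (d = d₀ → ∀ x, ∀ e ∈ S x, η x e = 0 → e = 0) := by
  classical
  obtain ⟨σ, hσ, hσm, rfl⟩ := h
  -- `τ` is the preimage of `σ`, with value `0` where `σ` has none.
  have hex : ∀ x, ∃ e ∈ S x, (∃ e' ∈ S x, η x e' = σ x) → η x e = σ x := fun x => by
    by_cases hx : ∃ e' ∈ S x, η x e' = σ x
    · exact ⟨hx.choose, hx.choose_spec.1, fun _ => hx.choose_spec.2⟩
    · exact ⟨0, zero_mem _, fun h => absurd h hx⟩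
  choose τ hτS hτ using hex
  -- The number `n` is the order of vanishing of `η` at `p`.
  have key : ∀ p, ∃ n : WithTop ℤ, 0 ≤ n ∧ n ≠ ⊤ ∧
      MeromorphicAt (localExpr F τ p) (chartAt ℂ p p) ∧
      sectionOrder F τ p = sectionOrder G σ p + -n ∧
      (n = 0 → ∀ e ∈ S p, η p e = 0 → e = 0) := by
    intro p
    obtain ⟨s, hs⟩ := hS.exists_frame p
    obtain ⟨u, hu⟩ := hT.exists_frame p
    obtain ⟨g, hg⟩ := IsLineSubbundle.exists_coeff hu hσ hσm
    have hηs : HolomorphicSectionAt G (fun x => η x (s x)) p := hη s p hs.self_of_nhds.1.1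
    have han := hηs.analyticAt_localExpr
    have hmemS : ∀ᶠ q in 𝓝 p, s q ∈ S q := by
      filter_upwards [hs] with q hq
      rw [hq.2]
      exact Submodule.mem_span_singleton_self _
    obtain ⟨k, hk⟩ := exists_coeff_of_frame hu (σ := fun x => η x (s x))
      (by filter_upwards [hmemS] with q hq using hηT q _ hq)
    have hk' : ∀ᶠ q in 𝓝[≠] p, η q (s q) = k q • u q := nhdsWithin_le_nhds hk
    have hkm : FnMeromorphicAt k p :=
      fnMeromorphicAt_of_frame hu.self_of_nhds.1 hk' han.meromorphicAt
    have hkord : meromorphicOrderAt (localExpr G (fun x => η x (s x)) p) (chartAt ℂ p p)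
        = fnOrder k p := sectionOrder_eq_fnOrder hu.self_of_nhds.1 hk' hkm
    have hktop : fnOrder k p ≠ ⊤ := by
      intro htop
      refine hnz p ?_
      filter_upwards [fnOrder_eq_top_iff.1 htop, hk', nhdsWithin_le_nhds hs] with q h1 h2 h3 e he
      rw [h3.2] at he
      obtain ⟨c, rfl⟩ := Submodule.mem_span_singleton.1 he
      rw [map_smul, h2, h1, zero_smul, smul_zero]
    have hk0 := (fnOrder_ne_top_iff hkm).1 hktop
    obtain ⟨-, hg1, hg2⟩ := hg.self_of_nhds
    have hτs : ∀ᶠ q in 𝓝[≠] p, τ q = (g q * (k q)⁻¹) • s q := by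
      filter_upwards [hk0, nhdsWithin_le_nhds hg, hk', nhdsWithin_le_nhds hs,
        nhdsWithin_le_nhds hu, nhdsWithin_le_nhds hmemS] with q h1 h2 h3 h4 h5 h6
      have h7 : η q (τ q) = σ q := hτ q
        ⟨(g q * (k q)⁻¹) • s q, Submodule.smul_mem _ _ h6, by
          rw [map_smul, h3, smul_smul, inv_mul_cancel_right₀ h1, h2.1]⟩
      have h8 := hτS q
      rw [h4.2] at h8
      obtain ⟨c, hc⟩ := Submodule.mem_span_singleton.1 h8
      rw [← hc, map_smul, h3, smul_smul, h2.1] at h7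
      rw [← hc, ← smul_left_injective ℂ h5.1.2 h7, mul_inv_cancel_right₀ h1]
    have hm := hg1.mul hkm.inv
    refine ⟨fnOrder k p, hkord ▸ han.meromorphicOrderAt_nonneg, hktop,
      meromorphicAt_localExpr_of_frame hs.self_of_nhds.1 hτs hm, ?_, ?_⟩
    · rw [sectionOrder_eq_fnOrder hs.self_of_nhds.1 hτs hm, fnOrder_mul hg1 hkm.inv, fnOrder_inv,
        hg2]
    · intro h0 e he hηe
      rw [hs.self_of_nhds.2] at he
      obtain ⟨c, rfl⟩ := Submodule.mem_span_singleton.1 he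
      have hne : η p (s p) ≠ 0 := by
        rw [← hkord, han.meromorphicOrderAt_eq] at h0
        have h1 : analyticOrderAt (localExpr G (fun x => η x (s x)) p) (chartAt ℂ p p) = 0 := by
          cases h2 : analyticOrderAt (localExpr G (fun x => η x (s x)) p) (chartAt ℂ p p) with
          | top => rw [h2] at h0; exact absurd h0 WithTop.top_ne_zero
          | coe m =>
            rw [h2] at h0
            have h3 : ((m : ℤ) : WithTop ℤ) = 0 := h0
            norm_cast at h3
            simp [h3]
        rw [han.analyticOrderAt_eq_zero] at h1
        exact (localExpr_self_eq_zero_iff (F := G) (fun x => η x (s x)) p).not.1 h1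
      rw [map_smul, smul_eq_zero] at hηe
      rw [hηe.resolve_right hne, zero_smul]
  choose n hn0 hntop hmero hord hinj using key
  have hnegtop : ∀ p, - n p ≠ ⊤ := fun p h => hntop p (by simpa using h)
  have hτm : IsNonzeroMeromorphicSection F τ := fun p => ⟨hmero p, by
    rw [hord p]
    exact WithTop.add_ne_top.2 ⟨(hσm p).2, hnegtop p⟩⟩
  have hσfin := finite_sectionOrder_ne_zero hT hσ hσm
  have hτfin := finite_sectionOrder_ne_zero hS hτS hτm
  have hn : ∀ p, (n p).untop₀ = (sectionOrder G σ p).untop₀ - (sectionOrder F τ p).untop₀ := by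
    intro p
    rw [hord p, WithTop.untop₀_add (hσm p).2 (hnegtop p), WithTop.untop₀_neg]
    ring
  have hnfin : (Function.support fun p => (n p).untop₀).Finite := by
    refine (hσfin.union hτfin).subset fun p hp => ?_
    by_contra hcon
    simp only [mem_union, mem_ofPred_eq, not_or, not_not] at hcon
    exact hp (by simp only [hn p, hcon.1, hcon.2, sub_zero])
  have hnn : ∀ p, 0 ≤ (n p).untop₀ := fun p => WithTop.untop₀_nonneg.2 (hn0 p)
  have hsum : ∑ᶠ p, (n p).untop₀
      = ∑ᶠ p, (sectionOrder G σ p).untop₀ - ∑ᶠ p, (sectionOrder F τ p).untop₀ := by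
    simp only [hn]
    exact finsum_sub_distrib hσfin hτfin
  refine ⟨_, ⟨τ, hτS, hτm, rfl⟩, ?_, fun heq x => hinj x ?_⟩
  · have := finsum_nonneg hnn
    linarith
  · have h1 := single_le_finsum x hnfin hnn
    rw [hsum, heq, sub_self] at h1
    have h2 := le_antisymm h1 (hnn x)
    rw [← WithTop.coe_untop₀_of_ne_top (hntop x), h2]
    rfl

end Maps

/-! ### Direct sums, homomorphisms and duals -/

/-- A homomorphism in local coordinates, applied to a vector of the model fibre. -/
theorem inCoordinates_hom_apply {X : Type*} [TopologicalSpace X]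
    {F₁ : Type*} [NormedAddCommGroup F₁] [NormedSpace ℂ F₁]
    {E₁ : X → Type*} [TopologicalSpace (TotalSpace F₁ E₁)] [∀ x, TopologicalSpace (E₁ x)]
    [∀ x, AddCommGroup (E₁ x)] [∀ x, Module ℂ (E₁ x)] [FiberBundle F₁ E₁] [VectorBundle ℂ F₁ E₁]
    {F₂ : Type*} [NormedAddCommGroup F₂] [NormedSpace ℂ F₂]
    {E₂ : X → Type*} [TopologicalSpace (TotalSpace F₂ E₂)] [∀ x, TopologicalSpace (E₂ x)]
    [∀ x, AddCommGroup (E₂ x)] [∀ x, Module ℂ (E₂ x)] [FiberBundle F₂ E₂] [VectorBundle ℂ F₂ E₂]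
    (φ : (x : X) → HomBundle E₁ E₂ x) {p x : X}
    (hx : x ∈ (trivializationAt F₁ E₁ p).baseSet) (hx' : x ∈ (trivializationAt F₂ E₂ p).baseSet)
    (f : F₁) : ContinuousLinearMap.inCoordinates F₁ E₁ F₂ E₂ p x p x (φ x) f =
      (trivializationAt F₂ E₂ p ⟨x, φ x ((trivializationAt F₁ E₁ p).symm x f)⟩).2 := by
  have h : ∀ ϕ : E₁ x →L[ℂ] E₂ x, ContinuousLinearMap.inCoordinates F₁ E₁ F₂ E₂ p x p x ϕ f =
      (trivializationAt F₂ E₂ p ⟨x, ϕ ((trivializationAt F₁ E₁ p).symm x f)⟩).2 := fun ϕ => by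
    rw [ContinuousLinearMap.inCoordinates_eq hx hx']
    rfl
  exact h (φ x)

section Constructions

variable {X : Type*} [TopologicalSpace X] [ChartedSpace ℂ X]
  {F₁ : Type*} [NormedAddCommGroup F₁] [NormedSpace ℂ F₁]
  {E₁ : X → Type*} [TopologicalSpace (TotalSpace F₁ E₁)] [∀ x, TopologicalSpace (E₁ x)]
  [FiberBundle F₁ E₁]
  {F₂ : Type*} [NormedAddCommGroup F₂] [NormedSpace ℂ F₂]
  {E₂ : X → Type*} [TopologicalSpace (TotalSpace F₂ E₂)] [∀ x, TopologicalSpace (E₂ x)]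
  [FiberBundle F₂ E₂]

variable [∀ x, AddCommGroup (E₁ x)] [∀ x, AddCommGroup (E₂ x)]

theorem holomorphicSectionAt_prod_iff {s : (x : X) → (E₁ ×ᵇ E₂) x} {p : X} :
    HolomorphicSectionAt (F₁ × F₂) s p ↔
      HolomorphicSectionAt F₁ (fun x => (s x).1) p ∧
        HolomorphicSectionAt F₂ (fun x => (s x).2) p := by
  simp only [HolomorphicSectionAt, contMDiffAt_section]
  exact contMDiffAt_prod_module_iff _

variable [∀ x, Module ℂ (E₁ x)] [VectorBundle ℂ F₁ E₁]
  [∀ x, Module ℂ (E₂ x)] [VectorBundle ℂ F₂ E₂]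
  [∀ x, IsTopologicalAddGroup (E₂ x)] [∀ x, ContinuousSMul ℂ (E₂ x)]

theorem HolomorphicSectionAt.hom_apply {φ : (x : X) → HomBundle E₁ E₂ x} {s : (x : X) → E₁ x}
    {p : X} (hφ : HolomorphicSectionAt (HomModel F₁ F₂) φ p) (hs : HolomorphicSectionAt F₁ s p) :
    HolomorphicSectionAt F₂ (fun x => φ x (s x)) p :=
  ContMDiffAt.clm_bundle_apply (F₁ := F₁) (F₂ := F₂) (E₁ := E₁) (E₂ := E₂) (b := fun x => x)
    (ϕ := φ) hφ hs

theorem holomorphicSectionAt_hom_iff {φ : (x : X) → HomBundle E₁ E₂ x} {p : X} :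
    HolomorphicSectionAt (HomModel F₁ F₂) φ p ↔
      ContMDiffAt 𝓘(ℂ) 𝓘(ℂ, F₁ →L[ℂ] F₂) ω
        (fun x => ContinuousLinearMap.inCoordinates F₁ E₁ F₂ E₂ p x p x (φ x)) p :=
  contMDiffAt_section (F := F₁ →L[ℂ] F₂) (E := fun x => E₁ x →L[ℂ] E₂ x) p

/-- The rank-one homomorphism `e ↦ φ e • s`. -/
noncomputable def rankOneHom {x : X} (φ : DualBundle E₁ x) (s : E₂ x) : HomBundle E₁ E₂ x :=
  ContinuousLinearMap.smulRight (φ : E₁ x →L[ℂ] ℂ) s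

theorem HolomorphicSectionAt.rankOneHom {φ : (x : X) → DualBundle E₁ x} {s : (x : X) → E₂ x}
    {p : X} (hφ : HolomorphicSectionAt (HomModel F₁ ℂ) φ p) (hs : HolomorphicSectionAt F₂ s p) :
    HolomorphicSectionAt (HomModel F₁ F₂) (fun x => HiggsSurface.rankOneHom (φ x) (s x)) p := by
  rw [holomorphicSectionAt_hom_iff] at hφ ⊢
  rw [HolomorphicSectionAt, contMDiffAt_section] at hs
  have h1 : ContMDiffAt 𝓘(ℂ) 𝓘(ℂ, F₁ →L[ℂ] F₂) ω (fun x =>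
      ContinuousLinearMap.smulRightL ℂ F₁ F₂
        (ContinuousLinearMap.inCoordinates F₁ E₁ ℂ (Trivial X ℂ) p x p x (φ x))
        (trivializationAt F₂ E₂ p (TotalSpace.mk' F₂ x (s x))).2) p :=
    (ContMDiffAt.clm_apply (contMDiffAt_const (c := ContinuousLinearMap.smulRightL ℂ F₁ F₂))
      hφ).clm_apply hs
  refine h1.congr_of_eventuallyEq ?_
  filter_upwards [eventually_mem_baseSet (F := F₁) (E := E₁) p,
    eventually_mem_baseSet (F := F₂) (E := E₂) p] with x hx hx'
  ext v
  refine (inCoordinates_hom_apply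
    (fun x => HiggsSurface.rankOneHom (φ x) (s x)) hx hx' v).trans ?_
  have h2 := inCoordinates_hom_apply (F₂ := ℂ) φ hx (mem_univ x) v
  refine Eq.trans ?_ (congrArg (· • (trivializationAt F₂ E₂ p (TotalSpace.mk' F₂ x (s x))).2)
    h2.symm)
  exact ((trivializationAt F₂ E₂ p).linear ℂ hx').map_smul _ _

end Constructions

theorem trivial_coord {X : Type*} [TopologicalSpace X] (p x : X) (c : ℂ) :
    (trivializationAt ℂ (Trivial X ℂ) p ⟨x, c⟩).2 = c := rfl

section Dual

variable {X : Type*} [TopologicalSpace X]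
  {L : X → Type*} [TopologicalSpace (TotalSpace ℂ L)]
  [∀ x, AddCommGroup (L x)] [∀ x, Module ℂ (L x)] [∀ x, TopologicalSpace (L x)]
  [FiberBundle ℂ L] [VectorBundle ℂ ℂ L]

variable (L) in
/-- A linear coordinate on the line `L x`. -/
noncomputable def fiberCoord (x : X) : L x ≃L[ℂ] ℂ :=
  (trivializationAt ℂ L x).continuousLinearEquivAt ℂ x (mem_baseSet_trivializationAt ℂ L x)

/-- The functional on the line `L x` that takes the value `1` at `u`; zero for `u = 0`. -/
noncomputable def dualVector {x : X} (u : L x) : DualBundle L x :=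
  ((fiberCoord L x u)⁻¹ • (fiberCoord L x : L x →L[ℂ] ℂ) : L x →L[ℂ] ℂ)

theorem dualVector_smul {x : X} (c : ℂ) (u : L x) :
    dualVector (c • u) = c⁻¹ • dualVector u := by
  refine DFunLike.ext _ _ fun l => ?_
  have h : (fiberCoord L x (c • u))⁻¹ * fiberCoord L x l
      = c⁻¹ * ((fiberCoord L x u)⁻¹ * fiberCoord L x l) := by
    rw [map_smul, smul_eq_mul, mul_inv, mul_assoc]
  exact h

theorem dualVector_apply_self {x : X} {u : L x} (hu : u ≠ 0) : dualVector u u = (1 : ℂ) :=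
  inv_mul_cancel₀ ((map_ne_zero_iff (fiberCoord L x) (fiberCoord L x).injective).2 hu)

theorem exists_eq_smul_of_ne_zero {F : Type*} [NormedAddCommGroup F] [NormedSpace ℂ F]
    (hF : Module.finrank ℂ F = 1)
    {E : X → Type*} [TopologicalSpace (TotalSpace F E)]
    [∀ x, AddCommGroup (E x)] [∀ x, Module ℂ (E x)] [∀ x, TopologicalSpace (E x)]
    [FiberBundle F E] [VectorBundle ℂ F E] {x : X} {u : E x} (hu : u ≠ 0) (v : E x) :
    ∃ c : ℂ, v = c • u := by
  have h := ((trivializationAt F E x).continuousLinearEquivAt ℂ x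
    (mem_baseSet_trivializationAt F E x)).toLinearEquiv.finrank_eq
  obtain ⟨c, hc⟩ := (finrank_eq_one_iff_of_nonzero' u hu).1 (h.trans hF) v
  exact ⟨c, hc.symm⟩

variable [ChartedSpace ℂ X]

/-- The dual frame of a holomorphic frame is holomorphic: in the trivialization of `L` the frame is
a nonvanishing function, and the dual frame is its inverse. -/
theorem IsFrameAt.holomorphicSectionAt_dualVector {s : (x : X) → L x} {p : X}
    (hs : IsFrameAt ℂ s p) :
    HolomorphicSectionAt (HomModel ℂ ℂ) (fun x => dualVector (s x)) p := by
  have h := hs.1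
  rw [HolomorphicSectionAt, contMDiffAt_section] at h
  rw [holomorphicSectionAt_hom_iff]
  have hcoord : ∀ x (hx : x ∈ (trivializationAt ℂ L p).baseSet) (u : L x),
      (trivializationAt ℂ L p).continuousLinearEquivAt ℂ x hx u
        = (trivializationAt ℂ L p (TotalSpace.mk' ℂ x u)).2 := fun x hx u => rfl
  have hne : (trivializationAt ℂ L p (TotalSpace.mk' ℂ p (s p))).2 ≠ 0 := by
    rw [← hcoord p (mem_baseSet_trivializationAt ℂ L p)]
    exact (map_ne_zero_iff _ (ContinuousLinearEquiv.injective _)).2 hs.2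
  have h1 : ContMDiffAt 𝓘(ℂ) 𝓘(ℂ, ℂ →L[ℂ] ℂ) ω (fun x =>
      (trivializationAt ℂ L p (TotalSpace.mk' ℂ x (s x))).2⁻¹ • ContinuousLinearMap.id ℂ ℂ) p :=
    (h.inv₀ hne).smul contMDiffAt_const
  refine h1.congr_of_eventuallyEq ?_
  filter_upwards [eventually_mem_baseSet (F := ℂ) (E := L) p, h.continuousAt.eventually_ne hne]
    with x hx hx0
  ext
  refine (inCoordinates_hom_apply (F₂ := ℂ) (fun x => dualVector (s x)) hx (mem_univ x) 1).trans ?_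
  have h2 : (trivializationAt ℂ L p).symm x 1
      = (trivializationAt ℂ L p (TotalSpace.mk' ℂ x (s x))).2⁻¹ • s x := by
    refine ((trivializationAt ℂ L p).continuousLinearEquivAt ℂ x hx).injective ?_
    rw [map_smul, hcoord, hcoord, smul_eq_mul, inv_mul_cancel₀ hx0]
    exact congrArg Prod.snd ((trivializationAt ℂ L p).apply_mk_symm hx 1)
  have hsx : s x ≠ 0 := by
    intro h0
    rw [h0] at hx0
    exact hx0 (((trivializationAt ℂ L p).linear ℂ hx).map_zero)
  rw [h2]
  refine (trivial_coord p x _).trans ?_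
  rw [map_smul, dualVector_apply_self hsx]
  simp

end Dual

/-! ### Line subbundles of `L ⊕ L⁻¹` -/

section RankTwo

theorem finrank_homModel : Module.finrank ℂ (HomModel ℂ ℂ) = 1 := by
  refine finrank_eq_one_iff'.2 ⟨(ContinuousLinearMap.id ℂ ℂ : ℂ →L[ℂ] ℂ), ?_, fun w => ?_⟩
  · intro h
    exact one_ne_zero (DFunLike.congr_fun (F := ℂ →L[ℂ] ℂ) h (1 : ℂ))
  · have h : ∀ w : ℂ →L[ℂ] ℂ, w 1 • ContinuousLinearMap.id ℂ ℂ = w := fun w => by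
      ext; simp
    exact ⟨_, h w⟩

/-- The line subbundle `0 ⊕ L⁻¹` of `L ⊕ L⁻¹`. -/
noncomputable def dualSubbundle {X : Type*} (L : X → Type*) [∀ x, AddCommGroup (L x)]
    [∀ x, Module ℂ (L x)] [∀ x, TopologicalSpace (L x)] (x : X) : Submodule ℂ ((L ×ᵇ DualBundle L) x) :=
  (⊤ : Submodule ℂ (DualBundle L x)).map (LinearMap.inr ℂ (L x) (DualBundle L x))

theorem mem_dualSubbundle {X : Type*} {L : X → Type*} [∀ x, AddCommGroup (L x)]
    [∀ x, Module ℂ (L x)] [∀ x, TopologicalSpace (L x)] {x : X} {e : (L ×ᵇ DualBundle L) x} :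
    e ∈ dualSubbundle L x ↔ e.1 = 0 := by
  constructor
  · rintro ⟨l, -, rfl⟩
    rfl
  · intro h
    exact ⟨e.2, trivial, Prod.ext h.symm rfl⟩

variable {X : Type*} [TopologicalSpace X] [ChartedSpace ℂ X]
  {L : X → Type*} [TopologicalSpace (TotalSpace ℂ L)]
  [∀ x, AddCommGroup (L x)] [∀ x, Module ℂ (L x)] [∀ x, TopologicalSpace (L x)]
  [FiberBundle ℂ L] [VectorBundle ℂ ℂ L]

/-- The inclusion of `L` into `L ⊕ L⁻¹` as the graph of `ψ : L → L⁻¹`. -/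
noncomputable def graphMap
    (ψ : HolomorphicSection (HomModel ℂ (HomModel ℂ ℂ)) (HomBundle L (DualBundle L))) (x : X) :
    L x →ₗ[ℂ] (L ×ᵇ DualBundle L) x :=
  LinearMap.prod LinearMap.id ((ψ x : L x →L[ℂ] DualBundle L x) : L x →ₗ[ℂ] DualBundle L x)

/-- The graph of `ψ : L → L⁻¹` as a line subbundle of `L ⊕ L⁻¹`. -/
noncomputable def graphSubbundle
    (ψ : HolomorphicSection (HomModel ℂ (HomModel ℂ ℂ)) (HomBundle L (DualBundle L))) (x : X) :
    Submodule ℂ ((L ×ᵇ DualBundle L) x) :=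
  (⊤ : Submodule ℂ (L x)).map (graphMap ψ x)

theorem mem_graphSubbundle
    {ψ : HolomorphicSection (HomModel ℂ (HomModel ℂ ℂ)) (HomBundle L (DualBundle L))} {x : X}
    {e : (L ×ᵇ DualBundle L) x} : e ∈ graphSubbundle ψ x ↔ e.2 = ψ x e.1 := by
  constructor
  · rintro ⟨l, -, rfl⟩
    rfl
  · intro h
    exact ⟨e.1, trivial, Prod.ext rfl h.symm⟩

theorem holomorphicSectionAt_graphMap
    (ψ : HolomorphicSection (HomModel ℂ (HomModel ℂ ℂ)) (HomBundle L (DualBundle L)))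
    (s : (x : X) → L x) (p : X) (hs : HolomorphicSectionAt ℂ s p) :
    HolomorphicSectionAt (ℂ × HomModel ℂ ℂ) (E := L ×ᵇ DualBundle L)
      (fun x => graphMap ψ x (s x)) p :=
  holomorphicSectionAt_prod_iff.2 ⟨hs, HolomorphicSectionAt.hom_apply (ψ.contMDiff p) hs⟩

theorem graphMap_injective
    (ψ : HolomorphicSection (HomModel ℂ (HomModel ℂ ℂ)) (HomBundle L (DualBundle L))) (x : X) :
    Function.Injective (graphMap ψ x) := fun _ _ h => congrArg Prod.fst h

theorem holomorphicSectionAt_inr (s : (x : X) → DualBundle L x) (p : X)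
    (hs : HolomorphicSectionAt (HomModel ℂ ℂ) s p) :
    HolomorphicSectionAt (ℂ × HomModel ℂ ℂ) (E := L ×ᵇ DualBundle L)
      (fun x => LinearMap.inr ℂ (L x) (DualBundle L x) (s x)) p :=
  holomorphicSectionAt_prod_iff.2 ⟨contMDiffAt_zeroSection ℂ L, hs⟩

variable [ContMDiffVectorBundle ω ℂ L 𝓘(ℂ)]

theorem isLineSubbundle_graph
    (ψ : HolomorphicSection (HomModel ℂ (HomModel ℂ ℂ)) (HomBundle L (DualBundle L))) :
    IsLineSubbundle (ℂ × HomModel ℂ ℂ) (graphSubbundle ψ) :=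
  (isLineSubbundle_top (Module.finrank_self ℂ)).map (graphMap_injective ψ)
    (holomorphicSectionAt_graphMap ψ)

theorem isLineSubbundle_dualSubbundle :
    IsLineSubbundle (ℂ × HomModel ℂ ℂ) (dualSubbundle L) :=
  (isLineSubbundle_top finrank_homModel).map (fun _ => LinearMap.inr_injective)
    holomorphicSectionAt_inr

variable [IsManifold 𝓘(ℂ) ω X]

/-- The dual `σ⁻¹` of a meromorphic section `σ` of `L` is a meromorphic section of `L⁻¹` with the
opposite divisor. -/
theorem LineBundleHasDegree.dual {d : ℤ} (h : LineBundleHasDegree L d) :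
    HasDegree (HomModel ℂ ℂ) (fun x => (⊤ : Submodule ℂ (DualBundle L x))) (-d) := by
  obtain ⟨σ, hσ, hσm, rfl⟩ := h
  have hL := isLineSubbundle_top (E := L) (Module.finrank_self ℂ)
  have key : ∀ p, MeromorphicAt (localExpr (HomModel ℂ ℂ) (fun x => dualVector (σ x)) p)
        (chartAt ℂ p p) ∧
      sectionOrder (HomModel ℂ ℂ) (fun x => dualVector (σ x)) p = - sectionOrder ℂ σ p := by
    intro p
    obtain ⟨s, hs⟩ := hL.exists_frame p
    obtain ⟨g, hg⟩ := IsLineSubbundle.exists_coeff hs hσ hσm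
    obtain ⟨-, hg1, hg2⟩ := hg.self_of_nhds
    have hsp := hs.self_of_nhds.1
    have hs' : IsFrameAt (HomModel ℂ ℂ) (fun x => dualVector (s x)) p := by
      refine ⟨hsp.holomorphicSectionAt_dualVector, fun h0 => ?_⟩
      have h1 := dualVector_apply_self hsp.2
      exact zero_ne_one (α := ℂ) ((DFunLike.congr_fun h0 (s p)).symm.trans h1)
    have h1 : ∀ᶠ q in 𝓝[≠] p, dualVector (σ q) = (g q)⁻¹ • dualVector (s q) := by
      filter_upwards [nhdsWithin_le_nhds hg] with q hq
      rw [hq.1, dualVector_smul]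
    refine ⟨meromorphicAt_localExpr_of_frame hs' h1 hg1.inv, ?_⟩
    rw [sectionOrder_eq_fnOrder hs' h1 hg1.inv, fnOrder_inv, hg2]
  refine ⟨fun x => dualVector (σ x), fun x => trivial, fun p => ⟨(key p).1, ?_⟩, ?_⟩
  · rw [(key p).2]
    exact fun h => (hσm p).2 (by simpa using h)
  · simp only [(key _).2, WithTop.untop₀_neg]
    exact finsum_neg_distrib _

theorem hasDegree_graph (hL : LineBundleHasDegree L 0)
    (ψ : HolomorphicSection (HomModel ℂ (HomModel ℂ ℂ)) (HomBundle L (DualBundle L))) :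
    HasDegree (ℂ × HomModel ℂ ℂ) (graphSubbundle ψ) 0 :=
  HasDegree.map (isLineSubbundle_top (Module.finrank_self ℂ)) (graphMap_injective ψ)
    (holomorphicSectionAt_graphMap ψ) hL

theorem hasDegree_dualSubbundle (hL : LineBundleHasDegree L 0) :
    HasDegree (ℂ × HomModel ℂ ℂ) (dualSubbundle L) 0 :=
  HasDegree.map (isLineSubbundle_top finrank_homModel) (fun _ => LinearMap.inr_injective)
    holomorphicSectionAt_inr (by simpa using hL.dual)

end RankTwo

/-! ### Invariant subbundles and stability -/

section Main

variable {X : Type*} [TopologicalSpace X]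
  {L : X → Type*} [TopologicalSpace (TotalSpace ℂ L)]
  [∀ x, AddCommGroup (L x)] [∀ x, Module ℂ (L x)] [∀ x, TopologicalSpace (L x)]
  [FiberBundle ℂ L] [VectorBundle ℂ ℂ L]

theorem exists_smul_of_ne_zero_dual {x : X} {u : DualBundle L x} (hu : u ≠ 0)
    (v : DualBundle L x) : ∃ c : ℂ, v = c • u :=
  exists_eq_smul_of_ne_zero finrank_homModel hu v

theorem rankOneHom_dualVector_apply {x : X} {u : L x} (hu : u ≠ 0) (w : DualBundle L x) (c : ℂ) :
    rankOneHom (dualVector u) w (c • u) = c • w := by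
  have h : rankOneHom (dualVector u) w u = w := by
    refine (?_ : rankOneHom (dualVector u) w u = (1 : ℂ) • w).trans (one_smul ℂ w)
    exact congrArg (fun c : ℂ => c • w) (dualVector_apply_self hu)
  rw [map_smul, h]

variable [ChartedSpace ℂ X]

/-- The fibres of a line subbundle are one-dimensional. -/
theorem IsLineSubbundle.exists_eq_smul {F : Type*} [NormedAddCommGroup F] [NormedSpace ℂ F]
    {E : X → Type*} [TopologicalSpace (TotalSpace F E)] [∀ x, AddCommGroup (E x)]
    [∀ x, Module ℂ (E x)] [∀ x, TopologicalSpace (E x)] [FiberBundle F E]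
    {S : (x : X) → Submodule ℂ (E x)} (hS : IsLineSubbundle F S) {x : X} {e f : E x}
    (he : e ∈ S x) (hf : f ∈ S x) (he0 : e ≠ 0) : ∃ c : ℂ, f = c • e := by
  obtain ⟨s, hs⟩ := hS.exists_frame x
  rw [hs.self_of_nhds.2] at he hf
  obtain ⟨a, rfl⟩ := Submodule.mem_span_singleton.1 he
  obtain ⟨b, rfl⟩ := Submodule.mem_span_singleton.1 hf
  have ha : a ≠ 0 := fun h => he0 (by rw [h, zero_smul])
  exact ⟨b * a⁻¹, by rw [smul_smul, inv_mul_cancel_right₀ ha]⟩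

theorem isCompl_graph_zero_dualSubbundle (x : X) :
    IsCompl (graphSubbundle (L := L) 0 x) (dualSubbundle L x) := by
  rw [isCompl_iff, Submodule.disjoint_def, Submodule.codisjoint_iff_exists_add_eq]
  refine ⟨fun e he he' => ?_, fun e => ⟨(e.1, 0), (0, e.2), mem_graphSubbundle.2 rfl,
    mem_dualSubbundle.2 rfl, Prod.ext (add_zero _) (zero_add _)⟩⟩
  rw [mem_graphSubbundle] at he
  exact Prod.ext (mem_dualSubbundle.1 he') he

/-- A line subbundle of `L ⊕ L⁻¹` that projects isomorphically to both summands is the graph of a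
holomorphic isomorphism `L → L⁻¹`. -/
theorem exists_eq_graphSubbundle {S : (x : X) → Submodule ℂ ((L ×ᵇ DualBundle L) x)}
    (hS : IsLineSubbundle (ℂ × HomModel ℂ ℂ) S)
    (h₁ : ∀ x, ∀ e ∈ S x, e.1 = 0 → e = 0) (h₂ : ∀ x, ∀ e ∈ S x, e.2 = 0 → e = 0) :
    ∃ ψ : HolomorphicSection (HomModel ℂ (HomModel ℂ ℂ)) (HomBundle L (DualBundle L)),
      (∀ x, Function.Bijective (ψ x)) ∧ ∀ x, S x = graphSubbundle ψ x := by
  choose s hs using hS.exists_frame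
  have hmem : ∀ p, ∀ᶠ x in 𝓝 p, s p x ∈ S x ∧ (s p x).1 ≠ 0 ∧ (s p x).2 ≠ 0 := by
    intro p
    filter_upwards [hs p] with x hx
    have hmem : s p x ∈ S x := by
      rw [hx.2]
      exact Submodule.mem_span_singleton_self _
    exact ⟨hmem, fun h0 => hx.1.2 (h₁ x _ hmem h0), fun h0 => hx.1.2 (h₂ x _ hmem h0)⟩
  -- Over each point a frame around that point is used; the value does not depend on the frame.
  set φ : (x : X) → HomBundle L (DualBundle L) x :=
    fun x => rankOneHom (dualVector (s x x).1) (s x x).2 with hφ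
  -- The homomorphism `φ x` maps the first component of any vector of `S x` to the second.
  have hφS : ∀ x, ∀ e ∈ S x, φ x e.1 = e.2 := by
    intro x e he
    rw [(hs x).self_of_nhds.2] at he
    obtain ⟨c, rfl⟩ := Submodule.mem_span_singleton.1 he
    exact rankOneHom_dualVector_apply (hmem x).self_of_nhds.2.1 _ c
  have hφeq : ∀ p, ∀ᶠ x in 𝓝 p, φ x = rankOneHom (dualVector (s p x).1) (s p x).2 := by
    intro p
    filter_upwards [hmem p] with x hx
    refine DFunLike.ext _ _ fun l => ?_
    obtain ⟨c, rfl⟩ := exists_eq_smul_of_ne_zero (Module.finrank_self ℂ) hx.2.1 l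
    rw [rankOneHom_dualVector_apply hx.2.1, map_smul, hφS x _ hx.1]
  have hφhol : ∀ p, HolomorphicSectionAt (HomModel ℂ (HomModel ℂ ℂ)) φ p := by
    intro p
    obtain ⟨h3, h4⟩ := holomorphicSectionAt_prod_iff.1 (hs p).self_of_nhds.1.1
    have h5 : IsFrameAt ℂ (fun x => (s p x).1) p := ⟨h3, (hmem p).self_of_nhds.2.1⟩
    refine ContMDiffAt.congr_of_eventuallyEq
      (HolomorphicSectionAt.rankOneHom h5.holomorphicSectionAt_dualVector h4) ?_
    filter_upwards [hφeq p] with x hx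
    rw [hx]
  refine ⟨⟨φ, fun p => hφhol p⟩, fun x => ⟨?_, ?_⟩, fun x => ?_⟩
  · refine (injective_iff_map_eq_zero (φ x)).2 fun l hl => ?_
    obtain ⟨c, rfl⟩ := exists_eq_smul_of_ne_zero (Module.finrank_self ℂ)
      (hmem x).self_of_nhds.2.1 l
    rw [map_smul, hφS x _ (hmem x).self_of_nhds.1] at hl
    rw [(smul_eq_zero.1 hl).resolve_right (hmem x).self_of_nhds.2.2, zero_smul]
  · intro w
    obtain ⟨c, rfl⟩ := exists_smul_of_ne_zero_dual (hmem x).self_of_nhds.2.2 w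
    refine ⟨c • (s x x).1, ?_⟩
    change φ x _ = _
    rw [map_smul, hφS x _ (hmem x).self_of_nhds.1]
  · ext e
    rw [mem_graphSubbundle]
    refine ⟨fun he => (hφS x e he).symm, fun he => ?_⟩
    obtain ⟨c, hc⟩ := exists_eq_smul_of_ne_zero (Module.finrank_self ℂ)
      (hmem x).self_of_nhds.2.1 e.1
    have h3 : e = c • s x x := by
      refine Prod.ext hc (he.trans ?_)
      rw [hc]
      change φ x _ = _
      rw [map_smul, hφS x _ (hmem x).self_of_nhds.1]
      rfl
    rw [h3]
    exact Submodule.smul_mem _ _ (hmem x).self_of_nhds.1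

variable [IsManifold 𝓘(ℂ) ω X] [∀ x, IsTopologicalAddGroup (L x)] [∀ x, ContinuousSMul ℂ (L x)]
  {α : HomForm (HomModel ℂ ℂ) ℂ (DualBundle L) L} {β : HomForm ℂ (HomModel ℂ ℂ) L (DualBundle L)}

theorem offDiagonal_apply (x : X) (v : TangentSpace 𝓘(ℂ) x) (e : (L ×ᵇ DualBundle L) x) :
    offDiagonal α β x v e = (α x v e.2, β x v e.1) := rfl

/-- If an invariant line subbundle coincides with `L⁻¹` near `p`, then `Φ` maps `L⁻¹` to itself near
`p`, so `α` vanishes there, and everywhere by the identity theorem. -/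
theorem eq_zero_of_eventually_fst_eq_zero [PreconnectedSpace X]
    {S : (x : X) → Submodule ℂ ((L ×ᵇ DualBundle L) x)}
    (hS : IsLineSubbundle (ℂ × HomModel ℂ ℂ) S) (hinv : IsInvariant (offDiagonal α β) S) {p : X}
    (h : ∀ᶠ q in 𝓝[≠] p, ∀ e ∈ S q, e.1 = 0) : α = 0 := by
  obtain ⟨s, hs⟩ := hS.exists_frame p
  refine ContMDiffSection.ext fun x => eq_zero_of_eventually_eq_zero (fun p => α.contMDiff p)
    (p₀ := p) ?_ x
  filter_upwards [h, nhdsWithin_le_nhds hs] with q hq hsq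
  have hmem : s q ∈ S q := by
    rw [hsq.2]
    exact Submodule.mem_span_singleton_self _
  have h2 : (s q).2 ≠ 0 := fun h0 => hsq.1.2 (Prod.ext (hq _ hmem) h0)
  refine DFunLike.ext _ _ fun v => DFunLike.ext _ _ fun m => ?_
  obtain ⟨c, rfl⟩ := exists_smul_of_ne_zero_dual h2 m
  have h3 : α q v (s q).2 = 0 := hq _ (hinv q v _ hmem)
  rw [map_smul, h3, smul_zero]
  rfl

/-- If an invariant line subbundle coincides with `L` near `p`, then `Φ` maps `L` to itself near `p`,
so `β` vanishes there, and everywhere by the identity theorem. -/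
theorem eq_zero_of_eventually_snd_eq_zero [PreconnectedSpace X]
    {S : (x : X) → Submodule ℂ ((L ×ᵇ DualBundle L) x)}
    (hS : IsLineSubbundle (ℂ × HomModel ℂ ℂ) S) (hinv : IsInvariant (offDiagonal α β) S) {p : X}
    (h : ∀ᶠ q in 𝓝[≠] p, ∀ e ∈ S q, e.2 = 0) : β = 0 := by
  obtain ⟨s, hs⟩ := hS.exists_frame p
  refine ContMDiffSection.ext fun x => eq_zero_of_eventually_eq_zero (fun p => β.contMDiff p)
    (p₀ := p) ?_ x
  filter_upwards [h, nhdsWithin_le_nhds hs] with q hq hsq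
  have hmem : s q ∈ S q := by
    rw [hsq.2]
    exact Submodule.mem_span_singleton_self _
  have h2 : (s q).1 ≠ 0 := fun h0 => hsq.1.2 (Prod.ext h0 (hq _ hmem))
  refine DFunLike.ext _ _ fun v => DFunLike.ext _ _ fun m => ?_
  obtain ⟨c, rfl⟩ := exists_eq_smul_of_ne_zero (Module.finrank_self ℂ) h2 m
  have h3 : β q v (s q).1 = 0 := hq _ (hinv q v _ hmem)
  rw [map_smul, h3, smul_zero]
  rfl

/-- `Φ (l, ψ l) = (α ψ l, β l)` lies on the graph of `ψ` when `ψ α ψ = β`. -/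
theorem isInvariant_graphSubbundle
    {ψ : HolomorphicSection (HomModel ℂ (HomModel ℂ ℂ)) (HomBundle L (DualBundle L))}
    (h : ∀ (x : X) (v : TangentSpace 𝓘(ℂ) x) (l : L x), ψ x (α x v (ψ x l)) = β x v l) :
    IsInvariant (offDiagonal α β) (graphSubbundle ψ) := by
  intro x v e he
  rw [mem_graphSubbundle] at he ⊢
  rw [offDiagonal_apply]
  simp only
  rw [he, h]

/-- A line subbundle of degree zero that is invariant under the Higgs field obstructs stability. -/
theorem not_isStable_of_hasDegree_zero [T2Space X] [CompactSpace X] [PreconnectedSpace X]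
    {S : (x : X) → Submodule ℂ ((L ×ᵇ DualBundle L) x)}
    (hS : IsLineSubbundle (ℂ × HomModel ℂ ℂ) S) (hinv : IsInvariant (offDiagonal α β) S)
    (hdeg : HasDegree (ℂ × HomModel ℂ ℂ) S 0) :
    ¬ IsStable (ℂ × HomModel ℂ ℂ) (offDiagonal α β) := by
  intro h
  obtain ⟨d, hd, hSd⟩ := h S hS hinv
  exact hd.ne (hSd.unique hS hdeg)

theorem isInvariant_dualSubbundle (hα : α = 0) :
    IsInvariant (offDiagonal α β) (dualSubbundle L) := by
  subst hα
  intro x v e _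
  exact mem_dualSubbundle.2 rfl

theorem isInvariant_graphSubbundle_zero (hβ : β = 0) :
    IsInvariant (offDiagonal α β) (graphSubbundle (L := L) 0) := by
  subst hβ
  intro x v e he
  rw [mem_graphSubbundle] at he ⊢
  rfl

/-- For `α = 0`, an invariant line is the kernel of the Higgs field wherever `β ≠ 0`. -/
theorem le_dualSubbundle (hα : α = 0) {S : (x : X) → Submodule ℂ ((L ×ᵇ DualBundle L) x)}
    (hS : IsLineSubbundle (ℂ × HomModel ℂ ℂ) S) (hinv : IsInvariant (offDiagonal α β) S) {x : X}
    (hβ : β x ≠ 0) : S x ≤ dualSubbundle L x := by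
  subst hα
  intro e he
  rw [mem_dualSubbundle]
  by_contra hne
  refine hβ (DFunLike.ext _ _ fun v => DFunLike.ext _ _ fun m => ?_)
  obtain ⟨k, rfl⟩ := exists_eq_smul_of_ne_zero (Module.finrank_self ℂ) hne m
  obtain ⟨c, hc⟩ := hS.exists_eq_smul he (hinv x v e he) fun h => hne (congrArg Prod.fst h)
  have h1 : (0 : L x) = c • e.1 := congrArg Prod.fst hc
  have h2 : β x v e.1 = c • e.2 := congrArg Prod.snd hc
  rw [(smul_eq_zero.1 h1.symm).resolve_right hne] at h2
  have h3 : β x v e.1 = 0 := h2.trans (zero_smul ℂ (e.2 : DualBundle L x))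
  rw [map_smul, h3, smul_zero]
  rfl

/-- For `β = 0`, an invariant line is the kernel of the Higgs field wherever `α ≠ 0`. -/
theorem le_graphSubbundle_zero (hβ : β = 0)
    {S : (x : X) → Submodule ℂ ((L ×ᵇ DualBundle L) x)}
    (hS : IsLineSubbundle (ℂ × HomModel ℂ ℂ) S) (hinv : IsInvariant (offDiagonal α β) S) {x : X}
    (hα : α x ≠ 0) : S x ≤ graphSubbundle (L := L) 0 x := by
  subst hβ
  intro e he
  rw [mem_graphSubbundle]
  by_contra hne
  have hne' : e.2 ≠ 0 := hne
  refine hα (DFunLike.ext _ _ fun v => DFunLike.ext _ _ fun m => ?_)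
  obtain ⟨k, rfl⟩ := exists_smul_of_ne_zero_dual hne' m
  obtain ⟨c, hc⟩ := hS.exists_eq_smul he (hinv x v e he) fun h => hne' (congrArg Prod.snd h)
  have h1 : (0 : DualBundle L x) = c • e.2 := congrArg Prod.snd hc
  have h2 : α x v e.2 = c • e.1 := congrArg Prod.fst hc
  rw [map_smul, h2, (smul_eq_zero.1 h1.symm).resolve_right hne', zero_smul, smul_zero]
  rfl

variable [ContMDiffVectorBundle ω ℂ L 𝓘(ℂ)]

/-- If `α` and `β` are nonzero and `(E, Φ)` is not stable, then a destabilizing subbundle is the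
graph of an isomorphism `ψ : L → L⁻¹` with `ψ α ψ = β`. -/
theorem exists_iso_of_not_isStable [T2Space X] [CompactSpace X] [PreconnectedSpace X]
    (hL : LineBundleHasDegree L 0) (hα : α ≠ 0) (hβ : β ≠ 0)
    (h : ¬ IsStable (ℂ × HomModel ℂ ℂ) (offDiagonal α β)) :
    ∃ ψ : HolomorphicSection (HomModel ℂ (HomModel ℂ ℂ)) (HomBundle L (DualBundle L)),
      (∀ x, Function.Bijective (ψ x)) ∧
      ∀ (x : X) (v : TangentSpace 𝓘(ℂ) x) (l : L x), ψ x (α x v (ψ x l)) = β x v l := by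
  rw [IsStable] at h
  push Not at h
  obtain ⟨S, hS, hinv, hdeg⟩ := h
  -- Neither projection of `S` vanishes identically, so both bound the degree of `S` by zero.
  obtain ⟨d₁, hd₁, hle₁, heq₁⟩ := HasDegree.exists_le_of_map hS
    (isLineSubbundle_top (E := L) (Module.finrank_self ℂ))
    (η := fun x => LinearMap.fst ℂ (L x) (DualBundle L x)) (fun _ _ _ => trivial)
    (fun s p hs => (holomorphicSectionAt_prod_iff.1 hs).1)
    (fun p hp => hα (eq_zero_of_eventually_fst_eq_zero hS hinv hp)) hL
  obtain ⟨d₂, hd₂, hle₂, heq₂⟩ := HasDegree.exists_le_of_map hS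
    (isLineSubbundle_top (E := DualBundle L) finrank_homModel)
    (η := fun x => LinearMap.snd ℂ (L x) (DualBundle L x)) (fun _ _ _ => trivial)
    (fun s p hs => (holomorphicSectionAt_prod_iff.1 hs).2)
    (fun p hp => hβ (eq_zero_of_eventually_snd_eq_zero hS hinv hp)) hL.dual
  have h0 : d₁ = 0 := by
    by_contra hne
    exact hdeg d₁ (lt_of_le_of_ne hle₁ hne) hd₁
  have h0' : d₂ = -0 := by rw [neg_zero, ← h0, hd₁.unique hS hd₂]
  obtain ⟨ψ, hψ, hSψ⟩ := exists_eq_graphSubbundle hS (heq₁ h0) (heq₂ h0')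
  refine ⟨ψ, hψ, fun x v l => ?_⟩
  have h1 : ((l, ψ x l) : (L ×ᵇ DualBundle L) x) ∈ S x := by
    rw [hSψ, mem_graphSubbundle]
  have h2 := hinv x v _ h1
  rw [hSψ, mem_graphSubbundle] at h2
  exact h2.symm

/-- If `(E, Φ)` is not stable, it is the direct sum of the graphs of `ψ` and `-ψ`, for an isomorphism
`ψ : L → L⁻¹` with `ψ α ψ = β`. -/
theorem isPolystable_of_ne_zero [T2Space X] [CompactSpace X] [PreconnectedSpace X]
    (hL : LineBundleHasDegree L 0) (hα : α ≠ 0) (hβ : β ≠ 0) :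
    IsPolystable (ℂ × HomModel ℂ ℂ) (offDiagonal α β) := by
  by_cases h : IsStable (ℂ × HomModel ℂ ℂ) (offDiagonal α β)
  · exact Or.inl h
  obtain ⟨ψ, hψ, hψαβ⟩ := exists_iso_of_not_isStable hL hα hβ h
  have hneg : ∀ x l, (-ψ) x l = -(ψ x l) := fun x l => rfl
  refine Or.inr ⟨graphSubbundle ψ, graphSubbundle (-ψ), ⟨isLineSubbundle_graph ψ,
    isInvariant_graphSubbundle hψαβ, hasDegree_graph hL ψ⟩, ⟨isLineSubbundle_graph (-ψ),
    isInvariant_graphSubbundle fun x v l => ?_, hasDegree_graph hL (-ψ)⟩, fun x => ?_⟩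
  · rw [hneg, hneg, map_neg, map_neg, neg_neg, hψαβ]
  · rw [isCompl_iff, Submodule.disjoint_def, Submodule.codisjoint_iff_exists_add_eq]
    refine ⟨fun e he he' => ?_, fun e => ?_⟩
    · rw [mem_graphSubbundle] at he he'
      rw [he, hneg, eq_neg_iff_add_eq_zero, ← two_smul ℂ, smul_eq_zero] at he'
      have h1 : ψ x e.1 = 0 := he'.resolve_left two_ne_zero
      refine Prod.ext ?_ (he.trans h1)
      exact (injective_iff_map_eq_zero (ψ x)).1 (hψ x).1 _ h1
    · -- `(l, ψ k) = ((l + k) / 2, ψ ((l + k) / 2)) + ((l - k) / 2, - ψ ((l - k) / 2))`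
      obtain ⟨k, hk⟩ := (hψ x).2 e.2
      refine ⟨((2 : ℂ)⁻¹ • (e.1 + k), ψ x ((2 : ℂ)⁻¹ • (e.1 + k))),
        ((2 : ℂ)⁻¹ • (e.1 - k), -ψ x ((2 : ℂ)⁻¹ • (e.1 - k))), mem_graphSubbundle.2 rfl,
        mem_graphSubbundle.2 rfl, Prod.ext ?_ ?_⟩
      · change (2 : ℂ)⁻¹ • (e.1 + k) + (2 : ℂ)⁻¹ • (e.1 - k) = e.1
        module
      · change ψ x ((2 : ℂ)⁻¹ • (e.1 + k)) + -ψ x ((2 : ℂ)⁻¹ • (e.1 - k)) = e.2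
        rw [← hk, map_smul, map_smul, map_add, map_sub]
        module

theorem isStrictlyPolystable_of_eq_zero [T2Space X] [CompactSpace X] [PreconnectedSpace X]
    (hL : LineBundleHasDegree L 0) (hα : α = 0) (hβ : β = 0) :
    IsStrictlyPolystable (ℂ × HomModel ℂ ℂ) (offDiagonal α β) :=
  ⟨Or.inr ⟨graphSubbundle 0, dualSubbundle L,
    ⟨isLineSubbundle_graph 0, isInvariant_graphSubbundle_zero hβ, hasDegree_graph hL 0⟩,
    ⟨isLineSubbundle_dualSubbundle, isInvariant_dualSubbundle hα, hasDegree_dualSubbundle hL⟩,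
    isCompl_graph_zero_dualSubbundle⟩,
    not_isStable_of_hasDegree_zero isLineSubbundle_dualSubbundle (isInvariant_dualSubbundle hα)
      (hasDegree_dualSubbundle hL)⟩

/-- For `α = 0` and `β ≠ 0` there is only one invariant line over a point where `β ≠ 0`, so there
are no two complementary ones. -/
theorem not_isPolystable_of_left_eq_zero [T2Space X] [CompactSpace X] [PreconnectedSpace X]
    (hL : LineBundleHasDegree L 0) (hα : α = 0) (hβ : β ≠ 0) :
    ¬ IsPolystable (ℂ × HomModel ℂ ℂ) (offDiagonal α β) := by
  rintro (h | ⟨S₁, S₂, ⟨h₁, hinv₁, -⟩, ⟨h₂, hinv₂, -⟩, hc⟩)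
  · exact not_isStable_of_hasDegree_zero isLineSubbundle_dualSubbundle
      (isInvariant_dualSubbundle hα) (hasDegree_dualSubbundle hL) h
  obtain ⟨x, hx⟩ : ∃ x, β x ≠ 0 := by
    by_contra hcon
    push Not at hcon
    exact hβ (ContMDiffSection.ext hcon)
  have htop : (⊤ : Submodule ℂ ((L ×ᵇ DualBundle L) x)) ≤ dualSubbundle L x := by
    rw [← (hc x).sup_eq_top]
    exact sup_le (le_dualSubbundle hα h₁ hinv₁ hx) (le_dualSubbundle hα h₂ hinv₂ hx)
  refine hx (DFunLike.ext _ _ fun v => DFunLike.ext _ _ fun l => ?_)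
  have hl : l = 0 := mem_dualSubbundle.1 (htop (x := (l, 0)) trivial)
  rw [hl, map_zero, map_zero]

/-- For `α ≠ 0` and `β = 0` there is only one invariant line over a point where `α ≠ 0`, so there
are no two complementary ones. -/
theorem not_isPolystable_of_right_eq_zero [T2Space X] [CompactSpace X] [PreconnectedSpace X]
    (hL : LineBundleHasDegree L 0) (hα : α ≠ 0) (hβ : β = 0) :
    ¬ IsPolystable (ℂ × HomModel ℂ ℂ) (offDiagonal α β) := by
  rintro (h | ⟨S₁, S₂, ⟨h₁, hinv₁, -⟩, ⟨h₂, hinv₂, -⟩, hc⟩)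
  · exact not_isStable_of_hasDegree_zero (isLineSubbundle_graph 0)
      (isInvariant_graphSubbundle_zero hβ) (hasDegree_graph hL 0) h
  obtain ⟨x, hx⟩ : ∃ x, α x ≠ 0 := by
    by_contra hcon
    push Not at hcon
    exact hα (ContMDiffSection.ext hcon)
  have htop : (⊤ : Submodule ℂ ((L ×ᵇ DualBundle L) x)) ≤ graphSubbundle (L := L) 0 x := by
    rw [← (hc x).sup_eq_top]
    exact sup_le (le_graphSubbundle_zero hβ h₁ hinv₁ hx) (le_graphSubbundle_zero hβ h₂ hinv₂ hx)
  refine hx (DFunLike.ext _ _ fun v => DFunLike.ext _ _ fun m => ?_)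
  have hm : m = 0 := mem_graphSubbundle.1 (htop (x := (0, m)) trivial)
  rw [hm, map_zero, map_zero]

end Main

end HiggsSurface

theorem mainTheorem8
    {X : Type*} [TopologicalSpace X] [T2Space X] [CompactSpace X] [ConnectedSpace X]
    [ChartedSpace ℂ X] [IsManifold 𝓘(ℂ) ω X]
    {L : X → Type*} [TopologicalSpace (TotalSpace ℂ L)]
    [∀ x, AddCommGroup (L x)] [∀ x, Module ℂ (L x)] [∀ x, TopologicalSpace (L x)]
    [∀ x, IsTopologicalAddGroup (L x)] [∀ x, ContinuousSMul ℂ (L x)]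
    [FiberBundle ℂ L] [VectorBundle ℂ ℂ L] [ContMDiffVectorBundle ω ℂ L 𝓘(ℂ)]
    (hL : HiggsSurface.LineBundleHasDegree L 0)
    (α : HiggsSurface.HomForm (HiggsSurface.HomModel ℂ ℂ) ℂ (HiggsSurface.DualBundle L) L)
    (β : HiggsSurface.HomForm ℂ (HiggsSurface.HomModel ℂ ℂ) L (HiggsSurface.DualBundle L)) :
    (α = 0 ∧ β = 0 → HiggsSurface.IsStrictlyPolystable (ℂ × HiggsSurface.HomModel ℂ ℂ)
      (HiggsSurface.offDiagonal α β)) ∧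
    (α ≠ 0 ∧ β ≠ 0 →
      HiggsSurface.IsPolystable (ℂ × HiggsSurface.HomModel ℂ ℂ) (HiggsSurface.offDiagonal α β) ∧
      (¬ HiggsSurface.Proportional α β →
        HiggsSurface.IsStable (ℂ × HiggsSurface.HomModel ℂ ℂ) (HiggsSurface.offDiagonal α β))) ∧
    ((α = 0 ∧ β ≠ 0) ∨ (α ≠ 0 ∧ β = 0) →
      ¬ HiggsSurface.IsStable (ℂ × HiggsSurface.HomModel ℂ ℂ) (HiggsSurface.offDiagonal α β) ∧
      ¬ HiggsSurface.IsPolystable (ℂ × HiggsSurface.HomModel ℂ ℂ)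
        (HiggsSurface.offDiagonal α β)) := by
  refine ⟨fun h => HiggsSurface.isStrictlyPolystable_of_eq_zero hL h.1 h.2, fun h =>
    ⟨HiggsSurface.isPolystable_of_ne_zero hL h.1 h.2, fun hprop => ?_⟩, ?_⟩
  · by_contra hst
    obtain ⟨ψ, hψ, hψαβ⟩ := HiggsSurface.exists_iso_of_not_isStable hL h.1 h.2 hst
    exact hprop ⟨ψ, hψ, Or.inl ⟨1, fun x v l => (hψαβ x v l).trans (one_smul ℂ _).symm⟩⟩
  · rintro (⟨hα, hβ⟩ | ⟨hα, hβ⟩)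
    · have h := HiggsSurface.not_isPolystable_of_left_eq_zero hL hα hβ
      exact ⟨fun hst => h (Or.inl hst), h⟩
    · have h := HiggsSurface.not_isPolystable_of_right_eq_zero hL hα hβ
      exact ⟨fun hst => h (Or.inl hst), h⟩
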